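/- \textbf{Theorem (Abstract Empirical Bootstrap Theorem).} Let $n\ge 4$, $p\ge 3$, and let $X_1,\dots,X_n$ be independent centered random vectors in $\mathbb R^p$ with $\mathrm E[X_{ij}^2]<\infty$ for all $i,j$. Let $Y_1,\dots,Y_n$ be independent with $Y_i\sim N(0,\mathrm E[X_iX_i'])$, and let $S_n^Y=n^{-1/2}\sum_{i=1}^n Y_i$. Write $X_1^n=(X_1,\dots,X_n)$ and $\bar X=n^{-1}\sum_{i=1}^n X_i$. Let $e_1,\dots,e_n$ be i.i.d. $N(0,1)$ random variables independent of $X_1^n$, and let $X_1^*,\dots,X_n^*$ be, conditionally on $X_1^n$, i.i.d. draws from the empirical distribution of $X_1,\dots,X_n$. Put $$S_n^{eX}=\frac1{\sqrt n}\sum_{i=1}^n e_i(X_i-\bar X),\qquad S_n^{X^*}=\frac1{\sqrt n}\sum_{i=1}^n (X_i^*-\bar X).$$ Let $\mathcal A^{\mathrm{re}}$ be the class of all sets $\{w\in\mathbb R^p: a_j\le w_j\le b_j \text{ for all } j=1,\dots,p\}$ with $-\infty\le a_j\le b_j\le\infty$, and define $$\rho_n^{MB}(\mathcal A^{\mathrm{re}})=\sup_{A\in\mathcal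 A^{\mathrm{re}}}|\Pr(S_n^{eX}\in A\mid X_1^n)-\Pr(S_n^Y\in A)|,\qquad \rho_n^{EB}(\mathcal A^{\mathrm{re}})=\sup_{A\in\mathcal A^{\mathrm{re}}}|\Pr(S_n^{X^*}\in A\mid X_1^n)-\Pr(S_n^Y\in A)|,$$ where the conditional probabilities are taken from regular conditional distributions given $X_1^n$. Let $\hat L_n=\max_{1\le j\le p} n^{-1}\sum_{i=1}^n|X_{ij}-\bar X_j|^3$ and, for $\phi>0$, $\hat M_n(\phi)=\hat M_{n,X}(\phi)+\hat M_{n,Y}(\phi)$ with $$\hat M_{n,X}(\phi)=\frac1n\sum_{i=1}^n\max_{1\le j\le p}|X_{ij}-\bar X_j|^3\,1\Big\{\max_{1\le j\le p}|X_{ij}-\bar X_j|>\frac{\sqrt n}{4\phi\log p}\Big\},$$ $$\hat M_{n,Y}(\phi)=\mathrm E\Big[\max_{1\le j\le p}|S_{nj}^{eX}|^3\,1\Big\{\max_{1\le j\le p}|S_{nj}^{eX}|>\frac{\sqrt n}{4\phi\log p}\Big\}\,\Big|\,X_1^n\Big].$$ For every $b>0$ there are constants $K_1,K_2>0$ depending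 only on $b$ such that, in every such setting, almost surely the following holds for all constants $\overline L_n,\overline M_n>0$. With $$\phi_n=K_2\Big(\frac{\overline L_n^2\log^4p}{n}\Big)^{-1/6},$$ on the event $$\Big\{n^{-1}\sum_{i=1}^n(X_{ij}-\bar X_j)^2\ge b\ \text{ for all } j=1,\dots,p\Big\}\cap\{\hat L_n\le\overline L_n\}\cap\{\hat M_n(\phi_n)\le\overline M_n\}$$ we have $$\rho_n^{EB}(\mathcal A^{\mathrm{re}})\le\rho_n^{MB}(\mathcal A^{\mathrm{re}})+K_1\left[\left(\frac{\overline L_n^2\log^7p}{n}\right)^{1/6}+\frac{\overline M_n}{\overline L_n}\right].$$ -/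

import Mathlib

open MeasureTheory ProbabilityTheory

noncomputable section

namespace HDBootstrap

/-- The class of all closed hyperrectangles `{w : a_j ≤ w_j ≤ b_j for all j}` in `ℝ^p`, where
`-∞ ≤ a_j ≤ b_j ≤ ∞`. -/
def hyperrectangles (p : ℕ) : Set (Set (Fin p → ℝ)) :=
  {A | ∃ a b : Fin p → EReal, (∀ j, a j ≤ b j) ∧
    A = {w | ∀ j, a j ≤ (w j : EReal) ∧ (w j : EReal) ≤ b j}}

/-- `sup_{A ∈ 𝒜} |μ(A) - ν(A)|`. -/
def supDist {p : ℕ} (𝒜 : Set (Set (Fin p → ℝ))) (μ ν : Measure (Fin p → ℝ)) : ℝ :=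
  ⨆ A : 𝒜, |μ.real (A : Set (Fin p → ℝ)) - ν.real (A : Set (Fin p → ℝ))|

/-- `max_j |w_j|`. -/
def maxAbs {p : ℕ} (w : Fin p → ℝ) : ℝ := ⨆ j, |w j|

/-- The average `n⁻¹ ∑_i x_i` of real numbers. -/
def avg {n : ℕ} (x : Fin n → ℝ) : ℝ := (∑ i, x i) / n

/-- The sample mean of the data `x_1, …, x_n ∈ ℝ^p`. -/
def sampleMean {n p : ℕ} (x : Fin n → Fin p → ℝ) : Fin p → ℝ := fun j => avg fun i => x i j

/-- The normalized sum `n^{-1/2} ∑_i y_i`. -/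
def normalizedSum {n p : ℕ} (y : Fin n → Fin p → ℝ) : Fin p → ℝ :=
  fun j => (∑ i, y i j) / √n

/-- The multiplier bootstrap sum `n^{-1/2} ∑_i e_i (x_i - x̄)`. -/
def multiplierSum {n p : ℕ} (e : Fin n → ℝ) (x : Fin n → Fin p → ℝ) : Fin p → ℝ :=
  normalizedSum fun i j => e i * (x i j - sampleMean x j)

/-- The empirical bootstrap sum `n^{-1/2} ∑_i (x*_i - x̄)`. -/
def empiricalSum {n p : ℕ} (xs x : Fin n → Fin p → ℝ) : Fin p → ℝ :=
  normalizedSum fun i j => xs i j - sampleMean x j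

/-- The empirical distribution `n⁻¹ ∑_i δ_{x_i}`. -/
def empiricalMeasure {n p : ℕ} (x : Fin n → Fin p → ℝ) : Measure (Fin p → ℝ) :=
  (n : ENNReal)⁻¹ • ∑ i, Measure.dirac (x i)

/-- The empirical variance of the `j`-th coordinate. -/
def empVar {n p : ℕ} (x : Fin n → Fin p → ℝ) (j : Fin p) : ℝ :=
  avg fun i => (x i j - sampleMean x j) ^ 2

/-- `max_j n⁻¹ ∑_i |x_ij - x̄_j|³`. -/
def LHat {n p : ℕ} (x : Fin n → Fin p → ℝ) : ℝ :=
  ⨆ j, avg fun i => |x i j - sampleMean x j| ^ 3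

open Classical in
/-- `max_j |w_j|³ 1{max_j |w_j| > √n / (4 φ log p)}`. -/
def truncCube {p : ℕ} (n : ℕ) (φ : ℝ) (w : Fin p → ℝ) : ℝ :=
  if √n / (4 * φ * Real.log p) < maxAbs w then maxAbs w ^ 3 else 0

/-- `n⁻¹ ∑_i max_j |x_ij - x̄_j|³ 1{max_j |x_ij - x̄_j| > √n / (4 φ log p)}`. -/
def MHatX {n p : ℕ} (φ : ℝ) (x : Fin n → Fin p → ℝ) : ℝ :=
  avg fun i => truncCube n φ fun j => x i j - sampleMean x j

section Random

variable {Ω : Type*} [MeasurableSpace Ω] (P : Measure Ω) [IsFiniteMeasure P] {n p : ℕ}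

/-- The data `X_1^n = (X_1, …, X_n)` as one random element. -/
def data (X : Fin n → Ω → Fin p → ℝ) : Ω → Fin n → Fin p → ℝ := fun ω i => X i ω

/-- The law of `S_n^Y = n^{-1/2} ∑_i Y_i`. -/
def lawSum (Y : Fin n → Ω → Fin p → ℝ) : Measure (Fin p → ℝ) :=
  P.map fun ω => normalizedSum (data Y ω)

/-- The conditional law of `S_n^{eX}` given `X_1^n`, at the outcome `ω`. -/
def condLawMB (e : Fin n → Ω → ℝ) (X : Fin n → Ω → Fin p → ℝ) (ω : Ω) : Measure (Fin p → ℝ) :=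
  condDistrib (fun ω' => multiplierSum (fun i => e i ω') (data X ω')) (data X) P (data X ω)

/-- The conditional law of `S_n^{X*}` given `X_1^n`, at the outcome `ω`. -/
def condLawEB (Xs X : Fin n → Ω → Fin p → ℝ) (ω : Ω) : Measure (Fin p → ℝ) :=
  condDistrib (fun ω' => empiricalSum (data Xs ω') (data X ω')) (data X) P (data X ω)

/-- `ρ_n^{MB}(𝒜) = sup_{A ∈ 𝒜} |Pr(S_n^{eX} ∈ A ∣ X_1^n) - Pr(S_n^Y ∈ A)|`. -/
def rhoMB (𝒜 : Set (Set (Fin p → ℝ))) (e : Fin n → Ω → ℝ) (X Y : Fin n → Ω → Fin p → ℝ)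
    (ω : Ω) : ℝ :=
  supDist 𝒜 (condLawMB P e X ω) (lawSum P Y)

/-- `ρ_n^{EB}(𝒜) = sup_{A ∈ 𝒜} |Pr(S_n^{X*} ∈ A ∣ X_1^n) - Pr(S_n^Y ∈ A)|`. -/
def rhoEB (𝒜 : Set (Set (Fin p → ℝ))) (Xs X Y : Fin n → Ω → Fin p → ℝ) (ω : Ω) : ℝ :=
  supDist 𝒜 (condLawEB P Xs X ω) (lawSum P Y)

/-- `E[max_j |S_nj^{eX}|³ 1{max_j |S_nj^{eX}| > √n / (4 φ log p)} ∣ X_1^n]`. -/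
def MHatY (φ : ℝ) (e : Fin n → Ω → ℝ) (X : Fin n → Ω → Fin p → ℝ) (ω : Ω) : ℝ :=
  ∫ s, truncCube n φ s ∂(condLawMB P e X ω)

/-- `M̂_n(φ) = M̂_{n,X}(φ) + M̂_{n,Y}(φ)`. -/
def MHat (φ : ℝ) (e : Fin n → Ω → ℝ) (X : Fin n → Ω → Fin p → ℝ) (ω : Ω) : ℝ :=
  MHatX φ (data X ω) + MHatY P φ e X ω

/-- The standing setup: `X_1, …, X_n` are independent centered random vectors in `ℝ^p` with finite
second moments, and `Y_1, …, Y_n` are independent with `Y_i ∼ N(0, E[X_i X_i'])`. -/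
structure IsSample (X Y : Fin n → Ω → Fin p → ℝ) : Prop where
  measurable_X : ∀ i, Measurable (X i)
  indep_X : iIndepFun X P
  memLp_X : ∀ i j, MemLp (fun ω => X i ω j) 2 P
  mean_X : ∀ i j, ∫ ω, X i ω j ∂P = 0
  measurable_Y : ∀ i, Measurable (Y i)
  indep_Y : iIndepFun Y P
  gaussian_Y : ∀ i, IsGaussian (P.map (Y i))
  mean_Y : ∀ i j, ∫ ω, Y i ω j ∂P = 0
  cov_Y : ∀ i j k, ∫ ω, Y i ω j * Y i ω k ∂P = ∫ ω, X i ω j * X i ω k ∂P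

/-- `e_1, …, e_n` are i.i.d. `N(0,1)` and independent of `X_1^n`. -/
structure IsMultiplier (e : Fin n → Ω → ℝ) (X : Fin n → Ω → Fin p → ℝ) : Prop where
  measurable : ∀ i, Measurable (e i)
  indep : iIndepFun e P
  law : ∀ i, P.map (e i) = gaussianReal 0 1
  indep_data : IndepFun (fun ω i => e i ω) (data X) P

/-- `X*_1, …, X*_n` are i.i.d. draws from the empirical distribution of `X_1, …, X_n`: given `X_1^n`,
the vector `(X*_1, …, X*_n)` is distributed as the `n`-fold product of the empirical distribution. -/
structure IsEmpiricalDraw (Xs X : Fin n → Ω → Fin p → ℝ) : Prop where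
  measurable : ∀ i, Measurable (Xs i)
  condLaw : ∀ᵐ x ∂(P.map (data X)),
    condDistrib (data Xs) (data X) P x = Measure.pi fun _ : Fin n => empiricalMeasure x

end Random

end HDBootstrap

end

open MeasureTheory ProbabilityTheory

noncomputable section

namespace HDBootstrap

/-! ### Gaussian anti-concentration for orthants -/

section Hazard

/-! For fixed data, the empirical bootstrap sum is a normalized sum of `n` i.i.d. draws from the
centred empirical distribution, while the multiplier bootstrap sum is Gaussian with exactly the same
covariance. The theorem is therefore a deterministic Gaussian approximation on boxes,
`exists_abs_real_ebLaw_sub_mbLaw_le`, followed by the triangle inequality through the law of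
`S_n^Y`. Null sets enter only when the conditional laws are identified, so the almost sure event
does not depend on the constants.

Appending to each vector its negative turns boxes into lower orthants in dimension `2p`. The
indicator of an orthant is smoothed to `g (φ F)`, with `g` a cutoff and `F` the log-sum-exp maximum
at inverse temperature `β = φ log p`. Lindeberg's argument replaces the draws one at a time by
independent Gaussian vectors of matching covariance. The first two orders of the Taylor expansion
cancel. For increments of norm at most `1/(4β)`, the third-order remainder lives on a strip where
`F` is within `O(1/φ)` of zero and costs `L`; larger increments cost the truncated moments in `M`.

The probability of the strip is at most a multiple of the unknown error `ρ` plus Gaussian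
anti-concentration of order `√(log p) / φ`. Choosing `K₂` small makes the accumulated bound `ρ ≤ ρ/2
+ …`, which is then solved for `ρ` (`abs_real_orthant_sub_le_of_exchange`). This step needs a single
Gaussian increment to have norm at most `1/(4β)` with probability at least `1/2`. If that fails, the
claimed bound already exceeds `1`.

Anti-concentration is Nazarov's inequality, `real_orthant_sub_le`. The boundary layer of an orthant
is split by which coordinate has the largest excess. Given the residuals from regression on that
coordinate, each piece is an initial segment of an up-set of the line, and the hazard rate of the
normal law controls it. Disjointness of the pieces avoids a factor equal to the dimension. -/

lemma gaussianPDFReal_zero_one (x : ℝ) :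
    gaussianPDFReal 0 1 x = (√(2 * Real.pi))⁻¹ * Real.exp (-x ^ 2 / 2) := by
  simp [gaussianPDFReal_def]

lemma gaussianPDFReal_zero_one_le (x : ℝ) : gaussianPDFReal 0 1 x ≤ Real.exp (-x ^ 2 / 2) := by
  rw [gaussianPDFReal_zero_one]
  refine mul_le_of_le_one_left (Real.exp_nonneg _) (inv_le_one_of_one_le₀ ?_)
  rw [Real.one_le_sqrt]
  nlinarith [Real.pi_gt_three]

lemma gaussianReal_Icc_le (u h : ℝ) (hh : 0 ≤ h) {B : ℝ}
    (hB : ∀ x ∈ Set.Icc u (u + h), gaussianPDFReal 0 1 x ≤ B) :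
    gaussianReal 0 1 (Set.Icc u (u + h)) ≤ ENNReal.ofReal (h * B) := by
  rw [gaussianReal_apply 0 one_ne_zero]
  calc ∫⁻ x in Set.Icc u (u + h), gaussianPDF 0 1 x
      ≤ ∫⁻ x in Set.Icc u (u + h), ENNReal.ofReal B :=
        setLIntegral_mono measurable_const fun x hx => ENNReal.ofReal_le_ofReal (hB x hx)
    _ = ENNReal.ofReal (h * B) := by
        rw [setLIntegral_const, Real.volume_Icc, mul_comm, ← ENNReal.ofReal_mul (by linarith)]
        ring_nf

lemma le_gaussianReal_Ioc (u h : ℝ) {B : ℝ} (hB0 : 0 ≤ B)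
    (hB : ∀ x ∈ Set.Ioc u (u + h), B ≤ gaussianPDFReal 0 1 x) :
    ENNReal.ofReal (B * h) ≤ gaussianReal 0 1 (Set.Ioc u (u + h)) := by
  rw [gaussianReal_apply 0 one_ne_zero]
  calc ENNReal.ofReal (B * h) = ∫⁻ x in Set.Ioc u (u + h), ENNReal.ofReal B := by
        rw [setLIntegral_const, Real.volume_Ioc, ← ENNReal.ofReal_mul hB0]
        ring_nf
    _ ≤ ∫⁻ x in Set.Ioc u (u + h), gaussianPDF 0 1 x :=
        setLIntegral_mono' measurableSet_Ioc fun x hx => ENNReal.ofReal_le_ofReal (hB x hx)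

/-- A Mills ratio bound: the density drops by at most a factor `8` on an interval of length
`1/(1+s)` to the right of `s`, and that interval lies in the tail. -/
lemma gaussianPDFReal_le_mul_tail_of_nonneg {s : ℝ} (hs : 0 ≤ s) :
    ENNReal.ofReal (gaussianPDFReal 0 1 s) ≤
      ENNReal.ofReal (8 * (1 + s)) * gaussianReal 0 1 (Set.Ioi s) := by
  set h : ℝ := 1 / (1 + s) with hh
  have h1s : (0 : ℝ) < 1 + s := by linarith
  have hh0 : 0 < h := by positivity
  have hh1 : h ≤ 1 := by rw [hh, div_le_one h1s]; linarith
  have hsh : s * h ≤ 1 := by rw [hh, mul_one_div, div_le_one h1s]; linarith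
  have key : ∀ x ∈ Set.Ioc s (s + h), gaussianPDFReal 0 1 s / 8 ≤ gaussianPDFReal 0 1 x := by
    intro x hx
    rw [gaussianPDFReal_zero_one, gaussianPDFReal_zero_one, mul_div_assoc]
    refine mul_le_mul_of_nonneg_left ?_ (by positivity)
    -- On this interval `x² - s² ≤ 2sh + h² ≤ 3`.
    have h8 : Real.exp (3 / 2) ≤ 8 := by
      have := Real.exp_one_lt_d9
      have h2 : Real.exp (3 / 2) ≤ Real.exp 2 := Real.exp_le_exp.2 (by norm_num)
      have h3 : Real.exp 2 = Real.exp 1 * Real.exp 1 := by rw [← Real.exp_add]; norm_num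
      nlinarith [Real.exp_pos 1]
    have h9 : Real.exp (-s ^ 2 / 2) ≤ Real.exp (3 / 2) * Real.exp (-x ^ 2 / 2) := by
      rw [← Real.exp_add]
      refine Real.exp_le_exp.2 ?_
      have := hx.1
      have := hx.2
      nlinarith
    have := Real.exp_pos (-x ^ 2 / 2)
    rw [div_le_iff₀ (by norm_num)]
    nlinarith
  have h1 := le_gaussianReal_Ioc s h (div_nonneg (gaussianPDFReal_nonneg 0 1 s) (by norm_num)) key
  calc ENNReal.ofReal (gaussianPDFReal 0 1 s)
      = ENNReal.ofReal (8 * (1 + s)) * ENNReal.ofReal (gaussianPDFReal 0 1 s / 8 * h) := by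
        rw [← ENNReal.ofReal_mul (by positivity), hh]
        congr 1
        field_simp
    _ ≤ _ := by
        gcongr
        exact h1.trans (measure_mono Set.Ioc_subset_Ioi_self)

lemma gaussianPDFReal_le_mul_tail {s x : ℝ} (hx : s ≤ x) :
    ENNReal.ofReal (gaussianPDFReal 0 1 x) ≤
      ENNReal.ofReal (8 * (1 + max s 0)) * gaussianReal 0 1 (Set.Ioi s) := by
  have hm : ∀ u v : ℝ, u ^ 2 ≤ v ^ 2 → gaussianPDFReal 0 1 v ≤ gaussianPDFReal 0 1 u := by
    intro u v huv
    rw [gaussianPDFReal_zero_one, gaussianPDFReal_zero_one]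
    refine mul_le_mul_of_nonneg_left (Real.exp_le_exp.2 (by linarith)) (by positivity)
  rcases le_total 0 s with hs | hs
  · rw [max_eq_left hs]
    refine le_trans (ENNReal.ofReal_le_ofReal (hm s x ?_)) (gaussianPDFReal_le_mul_tail_of_nonneg hs)
    nlinarith
  · rw [max_eq_right hs]
    refine le_trans (ENNReal.ofReal_le_ofReal (hm 0 x (by simpa using sq_nonneg x)))
      ((gaussianPDFReal_le_mul_tail_of_nonneg le_rfl).trans ?_)
    gcongr

/-- Among the up-closed subsets `U` of `(u, ∞)`, the standard Gaussian mass of the part of `U` within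
`ε` of `u` is a small fraction of the mass of `U`. -/
lemma gaussianReal_inter_Iic_le {U : Set ℝ} {u a ε : ℝ} (hU : IsUpperSet U) (hUu : U ⊆ Set.Ioi u)
    (ha : 0 ≤ a) (hua : u ≤ a) (hε : 0 ≤ ε) (hε1 : ε ≤ 1) :
    gaussianReal 0 1 (U ∩ Set.Iic (u + ε)) ≤
      ENNReal.ofReal (ε * (8 * (2 + a))) * gaussianReal 0 1 U := by
  rcases (U ∩ Set.Iic (u + ε)).eq_empty_or_nonempty with h | ⟨x₀, hx₀, hx₀'⟩
  · simp [h]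
  have hbdd : BddBelow U := ⟨u, fun x hx => (hUu hx).le⟩
  set s := sInf U with hs
  have hus : u ≤ s := le_csInf ⟨x₀, hx₀⟩ fun x hx => (hUu hx).le
  have hsx : s ≤ x₀ := csInf_le hbdd hx₀
  -- Up to its endpoint, `U` is the half-line starting at `s`, so the hazard bound at `s` applies.
  -- The endpoint satisfies `s ≤ u + ε ≤ a + 1`.
  have hsub : Set.Ioi s ⊆ U := by
    intro x hx
    obtain ⟨z, hz, hzx⟩ := exists_lt_of_csInf_lt ⟨x₀, hx₀⟩ hx
    exact hU hzx.le hz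
  have hcov : U ∩ Set.Iic (u + ε) ⊆ Set.Icc s (s + ε) := by
    rintro x ⟨hx, hx'⟩
    refine ⟨csInf_le hbdd hx, ?_⟩
    have : x ≤ u + ε := hx'
    linarith
  set T := gaussianReal 0 1 (Set.Ioi s) with hT
  have hTtop : T ≠ ⊤ := measure_ne_top _ _
  have hs1 : s ≤ a + 1 := by
    have : x₀ ≤ u + ε := hx₀'
    linarith
  have hmax : max s 0 ≤ a + 1 := max_le hs1 (by linarith)
  have hB : ∀ x ∈ Set.Icc s (s + ε), gaussianPDFReal 0 1 x ≤ 8 * (2 + a) * T.toReal := by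
    intro x hx
    have h := gaussianPDFReal_le_mul_tail hx.1
    rw [← hT, ← ENNReal.ofReal_toReal hTtop, ← ENNReal.ofReal_mul (by positivity)] at h
    refine (ENNReal.ofReal_le_ofReal_iff (by positivity)).1 (h.trans (ENNReal.ofReal_le_ofReal ?_))
    refine mul_le_mul_of_nonneg_right ?_ ENNReal.toReal_nonneg
    linarith
  calc gaussianReal 0 1 (U ∩ Set.Iic (u + ε)) ≤ gaussianReal 0 1 (Set.Icc s (s + ε)) :=
        measure_mono hcov
    _ ≤ ENNReal.ofReal (ε * (8 * (2 + a) * T.toReal)) := gaussianReal_Icc_le s ε hε hB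
    _ = ENNReal.ofReal (ε * (8 * (2 + a))) * T := by
        conv_rhs => rw [← ENNReal.ofReal_toReal hTtop]
        rw [← ENNReal.ofReal_mul (by positivity)]
        ring_nf
    _ ≤ _ := by
        gcongr
        exact measure_mono hsub

end Hazard

/-! ### Nazarov's inequality through the coordinate of largest excess -/

section Nazarov

variable {ι : Type*}

/-- The lower orthant `{z : z_k ≤ y_k for all k}`. -/
def orthant (y : ι → ℝ) : Set (ι → ℝ) := {z | ∀ k, z k ≤ y k}

/-- `z_k - y_k` is positive and is the largest of the `z_j - y_j`; ties are broken by the rank. -/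
def argmaxSet (rk : ι → ℕ) (y : ι → ℝ) (k : ι) : Set (ι → ℝ) :=
  {z | y k < z k ∧ ∀ j, z j - y j ≤ z k - y k ∧ (rk j < rk k → z j - y j < z k - y k)}

lemma pairwise_disjoint_argmaxSet {rk : ι → ℕ} (hrk : Function.Injective rk) (y : ι → ℝ) :
    Pairwise (Function.onFun Disjoint (argmaxSet rk y)) := by
  intro k l hkl
  refine Set.disjoint_left.2 fun z hk hl => ?_
  rcases lt_or_gt_of_ne (hrk.ne hkl) with h | h
  · have := (hl.2 k).2 h
    have := (hk.2 l).1
    linarith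
  · have := (hk.2 l).2 h
    have := (hl.2 k).1
    linarith

variable [Fintype ι]

lemma measurableSet_orthant (y : ι → ℝ) : MeasurableSet (orthant y) := by
  have : orthant y = Set.Iic y := rfl
  rw [this]; exact measurableSet_Iic

lemma measurableSet_argmaxSet (rk : ι → ℕ) (y : ι → ℝ) (k : ι) :
    MeasurableSet (argmaxSet rk y k) := by
  have h : argmaxSet rk y k = {z : ι → ℝ | y k < z k} ∩
      ⋂ j, ({z : ι → ℝ | z j - y j ≤ z k - y k} ∩
        {z : ι → ℝ | rk j < rk k → z j - y j < z k - y k}) := by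
    ext z; simp [argmaxSet]
  rw [h]
  refine (measurableSet_lt (by fun_prop) (by fun_prop)).inter
    (MeasurableSet.iInter fun j => (measurableSet_le (by fun_prop) (by fun_prop)).inter ?_)
  by_cases hjk : rk j < rk k
  · simp only [hjk, true_imp_iff]
    exact measurableSet_lt (by fun_prop) (by fun_prop)
  · simp [hjk]

lemma orthant_add_sdiff_subset (rk : ι → ℕ) (y : ι → ℝ) (ε : ℝ) :
    orthant (fun k => y k + ε) \ orthant y ⊆ ⋃ k, argmaxSet rk y k ∩ {z | z k ≤ y k + ε} := by
  classical
  rintro z ⟨h1, h2⟩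
  obtain ⟨k₀, hk₀⟩ : ∃ k, y k < z k := by simpa [orthant] using h2
  obtain ⟨k₁, -, hk₁⟩ := Finset.exists_max_image Finset.univ (fun k => z k - y k) ⟨k₀, by simp⟩
  -- Among the maximizers of the excess, the one of least rank is the one selected by `argmaxSet`.
  obtain ⟨k, hk, hkmin⟩ := Finset.exists_min_image
    (Finset.univ.filter fun k => z k - y k = z k₁ - y k₁) rk ⟨k₁, by simp⟩
  simp only [Finset.mem_filter, Finset.mem_univ, true_and] at hk hkmin hk₁
  refine Set.mem_iUnion.2 ⟨k, ⟨?_, fun j => ⟨?_, fun hj => ?_⟩⟩, h1 k⟩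
  · have := hk₁ k₀ trivial
    linarith
  · have := hk₁ j trivial
    linarith
  · refine lt_of_le_of_ne (by have := hk₁ j trivial; linarith) fun h => ?_
    have := hkmin j (h.trans hk)
    omega

variable {μ : Measure (ι → ℝ)} [IsGaussian μ]

/-- Regression of all coordinates on the `k`-th. -/
lemma exists_map_eq_prod (hμ : ∀ k, μ.map (fun z => z k) = gaussianReal 0 1) (k : ι) :
    ∃ (ρ : ι → ℝ) (η : Measure (ι → ℝ)), IsProbabilityMeasure η ∧ (∀ j, ρ j ≤ 1) ∧ ρ k = 1 ∧
      μ.map (fun z => (z k, fun j => z j - ρ j * z k)) = (gaussianReal 0 1).prod η := by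
  have hL : ∀ j, MemLp (fun z : ι → ℝ => z j) 2 μ := fun j =>
    (IsGaussian.memLp_id μ 2 (by simp)).eval j
  have hvar : ∀ j, Var[fun z : ι → ℝ => z j; μ] = 1 := by
    intro j
    have h := variance_id_gaussianReal (μ := 0) (v := 1)
    rw [← hμ j, variance_map aemeasurable_id (measurable_pi_apply j).aemeasurable] at h
    simpa using h
  set ρ : ι → ℝ := fun j => cov[fun z : ι → ℝ => z j, fun z => z k; μ] with hρ
  have hkk : ρ k = 1 := by
    simp only [hρ]
    rw [covariance_self (measurable_pi_apply k).aemeasurable, hvar]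
  have hmeas : Measurable fun z : ι → ℝ => (fun j => z j - ρ j * z k : ι → ℝ) := by fun_prop
  refine ⟨ρ, μ.map (fun z j => z j - ρ j * z k), Measure.isProbabilityMeasure_map hmeas.aemeasurable,
    fun j => ?_, hkk, ?_⟩
  -- With unit variances, `Var(z j - z k) = 2 - 2 ρ j`.
  · have h := variance_nonneg (fun z : ι → ℝ => z j - z k) μ
    rw [variance_fun_sub (hL j) (hL k), hvar, hvar] at h
    simp only [hρ]
    linarith
  -- The residuals are uncorrelated with the `k`-th coordinate, hence independent of it by joint
  -- Gaussianity. The coordinate is viewed as a vector over `Unit` to fit the criterion for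
  -- families.
  · let Lk : (ι → ℝ) →L[ℝ] (Unit → ℝ) :=
      ContinuousLinearMap.pi fun _ => ContinuousLinearMap.proj k
    let R : (ι → ℝ) →L[ℝ] (ι → ℝ) :=
      ContinuousLinearMap.pi fun j => ContinuousLinearMap.proj j - ρ j • ContinuousLinearMap.proj k
    have hG : HasGaussianLaw (fun z => (fun i : Unit => Lk z i, fun j => R z j)) μ :=
      (IsGaussian.hasGaussianLaw_id (μ := μ)).map_fun (Lk.prod R)
    have hind := hG.indepFun_of_covariance_eval (fun _ j => by
      have h1 : (fun z : ι → ℝ => R z j) = (fun z => z j) - fun z => ρ j * z k := by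
        ext z; simp [R]
      have h2 : ∀ i, (fun z : ι → ℝ => Lk z i) = fun z => z k := by
        intro i; ext z; simp [Lk]
      rw [h1, h2, covariance_comm, covariance_sub_left (hL j) ((hL k).const_mul _) (hL k),
        covariance_const_mul_left]
      change ρ j - ρ j * ρ k = 0
      rw [hkk]; ring)
    have hu : Measurable fun f : Unit → ℝ => f () := measurable_pi_apply ()
    have hind2 := hind.comp (φ := fun f : Unit → ℝ => f ()) (ψ := id)
      hu measurable_id
    rw [indepFun_iff_map_prod_eq_prod_map_map (by fun_prop) (by fun_prop)] at hind2
    rw [← hμ k]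
    exact hind2

/-- With the residuals `r` frozen, `z j - z k = r j + (ρ j - 1) t` is nonincreasing in `t = z k`
because `ρ j ≤ 1`. Raising `t` thus keeps `k` the leading coordinate, so the slice is an up-set and
the one-dimensional hazard estimate can be integrated over `r`. -/
lemma measure_argmaxSet_inter_le (hμ : ∀ k, μ.map (fun z => z k) = gaussianReal 0 1)
    (rk : ι → ℕ) (y : ι → ℝ) (k : ι) {a ε : ℝ} (ha : 0 ≤ a) (hya : y k ≤ a) (hε : 0 ≤ ε)
    (hε1 : ε ≤ 1) :
    μ (argmaxSet rk y k ∩ {z | z k ≤ y k + ε}) ≤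
      ENNReal.ofReal (ε * (8 * (2 + a))) * μ (argmaxSet rk y k) := by
  obtain ⟨ρ, η, hη, hρ, hρk, hmap⟩ := exists_map_eq_prod hμ k
  set Φ : (ι → ℝ) → ℝ × (ι → ℝ) := fun z => (z k, fun j => z j - ρ j * z k) with hΦ
  set Ψ : ℝ × (ι → ℝ) → ι → ℝ := fun q j => q.2 j + ρ j * q.1 with hΨ
  have hΦm : Measurable Φ := by fun_prop
  have hΨm : Measurable Ψ := by fun_prop
  have hΨΦ : ∀ z, Ψ (Φ z) = z := by intro z; ext j; simp [hΨ, hΦ]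
  have hpull : ∀ S : Set (ι → ℝ), MeasurableSet S →
      μ S = ∫⁻ r, gaussianReal 0 1 {t | Ψ (t, r) ∈ S} ∂η := by
    intro S hS
    have h1 : S = Φ ⁻¹' (Ψ ⁻¹' S) := by ext z; simp [hΨΦ]
    conv_lhs => rw [h1, ← Measure.map_apply hΦm (hΨm hS), hmap, Measure.prod_apply_symm (hΨm hS)]
    rfl
  have hA := measurableSet_argmaxSet rk y k
  have hE : MeasurableSet {z : ι → ℝ | z k ≤ y k + ε} :=
    measurableSet_le (by fun_prop) (by fun_prop)
  rw [hpull _ (hA.inter hE), hpull _ hA, ← lintegral_const_mul']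
  swap
  · exact ENNReal.ofReal_ne_top
  refine lintegral_mono_ae ?_
  -- Since `ρ k = 1`, the `k`-th residual vanishes and `t` is the `k`-th coordinate itself.
  have hηk : ∀ᵐ r ∂η, r k = 0 := by
    have h1 : (gaussianReal 0 1).prod η {q : ℝ × (ι → ℝ) | q.2 k ≠ 0} = 0 := by
      rw [← hmap, Measure.map_apply hΦm]
      · simp [hΦ, hρk]
      · exact (measurableSet_eq_fun (by fun_prop) (by fun_prop)).compl
    have h2 : {q : ℝ × (ι → ℝ) | q.2 k ≠ 0} = Set.univ ×ˢ {r | r k ≠ 0} := by ext; simp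
    rw [h2, Measure.prod_prod] at h1
    simpa [ae_iff] using h1
  filter_upwards [hηk] with r hr
  have hk : ∀ t, Ψ (t, r) k = t := by intro t; simp [hΨ, hr, hρk]
  have hset : {t | Ψ (t, r) ∈ argmaxSet rk y k ∩ {z | z k ≤ y k + ε}} =
      {t | Ψ (t, r) ∈ argmaxSet rk y k} ∩ Set.Iic (y k + ε) := by
    ext t; simp [hk]
  rw [hset]
  refine gaussianReal_inter_Iic_le ?_ ?_ ha hya hε hε1
  · intro t t' htt ht
    refine ⟨?_, fun j => ?_⟩
    · rw [hk]
      have := ht.1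
      rw [hk] at this
      linarith
    · have h1 := (ht.2 j)
      rw [hk] at h1 ⊢
      have h2 : Ψ (t', r) j - t' ≤ Ψ (t, r) j - t := by
        simp only [hΨ]
        nlinarith [hρ j]
      exact ⟨by linarith [h1.1], fun h => by linarith [h1.2 h]⟩
  · intro t ht
    have := ht.1
    rw [hk] at this
    exact this

/-- Nazarov's inequality for Gaussian vectors with standard normal coordinates. -/
lemma measure_orthant_sdiff_le_of_standard (hμ : ∀ k, μ.map (fun z => z k) = gaussianReal 0 1)
    (y : ι → ℝ) {a ε : ℝ} (ha : 0 ≤ a) (hε : 0 ≤ ε) (hε1 : ε ≤ 1) :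
    μ (orthant (fun k => y k + ε) \ orthant y) ≤
      ENNReal.ofReal (ε * (8 * (2 + a) + Fintype.card ι * Real.exp (-a ^ 2 / 2))) := by
  set rk : ι → ℕ := fun k => (Fintype.equivFin ι k : ℕ) with hrk
  have hinj : Function.Injective rk := fun i j h =>
    (Fintype.equivFin ι).injective (Fin.val_injective h)
  have hk : ∀ k, μ (argmaxSet rk y k ∩ {z | z k ≤ y k + ε}) ≤
      ENNReal.ofReal (ε * (8 * (2 + a))) * μ (argmaxSet rk y k) +
        ENNReal.ofReal (ε * Real.exp (-a ^ 2 / 2)) := by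
    intro k
    -- Moderate thresholds use the hazard bound, whose total over `k` is at most one multiple of it.
    -- High thresholds use the small density beyond `a`, which can afford a union bound.
    rcases le_total (y k) a with h | h
    · exact (measure_argmaxSet_inter_le hμ rk y k ha h hε hε1).trans le_self_add
    · refine le_trans ?_ le_add_self
      calc μ (argmaxSet rk y k ∩ {z | z k ≤ y k + ε})
          ≤ μ ((fun z => z k) ⁻¹' Set.Icc (y k) (y k + ε)) :=
            measure_mono fun z hz => ⟨hz.1.1.le, hz.2⟩
        _ = gaussianReal 0 1 (Set.Icc (y k) (y k + ε)) := by
            rw [← hμ k, Measure.map_apply (by fun_prop) measurableSet_Icc]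
        _ ≤ _ := gaussianReal_Icc_le _ _ hε fun x hx =>
            (gaussianPDFReal_zero_one_le x).trans (Real.exp_le_exp.2 (by nlinarith [hx.1]))
  calc μ (orthant (fun k => y k + ε) \ orthant y)
      ≤ μ (⋃ k, argmaxSet rk y k ∩ {z | z k ≤ y k + ε}) :=
        measure_mono (orthant_add_sdiff_subset rk y ε)
    _ ≤ ∑ k, μ (argmaxSet rk y k ∩ {z | z k ≤ y k + ε}) := measure_iUnion_fintype_le _ _
    _ ≤ ∑ k, (ENNReal.ofReal (ε * (8 * (2 + a))) * μ (argmaxSet rk y k) +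
        ENNReal.ofReal (ε * Real.exp (-a ^ 2 / 2))) := Finset.sum_le_sum fun k _ => hk k
    _ = ENNReal.ofReal (ε * (8 * (2 + a))) * ∑ k, μ (argmaxSet rk y k) +
        Fintype.card ι * ENNReal.ofReal (ε * Real.exp (-a ^ 2 / 2)) := by
        rw [Finset.sum_add_distrib, Finset.mul_sum]
        simp
    _ ≤ ENNReal.ofReal (ε * (8 * (2 + a))) * 1 +
        Fintype.card ι * ENNReal.ofReal (ε * Real.exp (-a ^ 2 / 2)) := by
        gcongr
        rw [← measure_univ (μ := μ)]
        exact sum_measure_le_measure_univ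
          (fun k _ => (measurableSet_argmaxSet rk y k).nullMeasurableSet)
          (fun k _ l _ h => (pairwise_disjoint_argmaxSet hinj y h).aedisjoint)
    _ = _ := by
        rw [mul_one, ← ENNReal.ofReal_natCast, ← ENNReal.ofReal_mul (by positivity),
          ← ENNReal.ofReal_add (by positivity) (by positivity)]
        ring_nf

lemma real_orthant_sub_le_of_standard (hμ : ∀ k, μ.map (fun z => z k) = gaussianReal 0 1)
    (y : ι → ℝ) {ε ℓ : ℝ} (hε : 0 ≤ ε) (hℓ : 1 ≤ ℓ) (hcard : Fintype.card ι ≤ Real.exp (2 * ℓ)) :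
    μ.real (orthant fun k => y k + ε) - μ.real (orthant y) ≤ 33 * √ℓ * ε := by
  have hsq : 1 ≤ √ℓ := Real.one_le_sqrt.2 hℓ
  rcases le_total ε 1 with hε1 | hε1
  -- The level `a = 2√ℓ` makes `exp (-a²/2) = exp (-2ℓ)` cancel the dimension. Then `8 (2 + 2√ℓ) + 1
  -- ≤ 33 √ℓ`.
  · have h := measure_orthant_sdiff_le_of_standard hμ y (a := 2 * √ℓ) (by positivity) hε hε1
    have h2 : (Fintype.card ι : ℝ) * Real.exp (-(2 * √ℓ) ^ 2 / 2) ≤ 1 := by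
      have : -(2 * √ℓ) ^ 2 / 2 = -(2 * ℓ) := by
        rw [mul_pow, Real.sq_sqrt (by linarith)]; ring
      rw [this, Real.exp_neg, ← div_eq_mul_inv, div_le_one (Real.exp_pos _)]
      exact hcard
    have h3 : μ.real (orthant (fun k => y k + ε) \ orthant y) =
        μ.real (orthant fun k => y k + ε) - μ.real (orthant y) :=
      measureReal_sdiff (fun z hz k => (hz k).trans (by linarith)) (measurableSet_orthant y)
    rw [← h3]
    refine (ENNReal.toReal_mono ENNReal.ofReal_ne_top h).trans ?_
    rw [ENNReal.toReal_ofReal (by positivity)]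
    nlinarith
  · have h1 : μ.real (orthant fun k => y k + ε) ≤ 1 := measureReal_le_one
    have h2 : 0 ≤ μ.real (orthant y) := measureReal_nonneg
    nlinarith

/-- Nazarov's inequality. -/
theorem real_orthant_sub_le {σ : ι → ℝ} {s : ℝ} (hs : 0 < s) (hσ : ∀ k, s ≤ σ k)
    (hμ : ∀ k, μ.map (fun z => z k) = gaussianReal 0 (σ k ^ 2).toNNReal)
    (y : ι → ℝ) {ε ℓ : ℝ} (hε : 0 ≤ ε) (hℓ : 1 ≤ ℓ) (hcard : Fintype.card ι ≤ Real.exp (2 * ℓ)) :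
    μ.real (orthant fun k => y k + ε) - μ.real (orthant y) ≤ 33 / s * √ℓ * ε := by
  have hσ0 : ∀ k, 0 < σ k := fun k => hs.trans_le (hσ k)
  let D : (ι → ℝ) →L[ℝ] (ι → ℝ) :=
    ContinuousLinearMap.pi fun j => (σ j)⁻¹ • ContinuousLinearMap.proj j
  have hD : ∀ z j, D z j = (σ j)⁻¹ * z j := fun z j => by simp [D]
  have hDm : Measurable D := D.continuous.measurable
  have hst : ∀ k, (μ.map D).map (fun z => z k) = gaussianReal 0 1 := by
    intro k
    rw [Measure.map_map (by fun_prop) hDm]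
    have : (fun z : ι → ℝ => z k) ∘ D = (fun t => (σ k)⁻¹ * t) ∘ fun z => z k := by
      ext z; simp [hD]
    rw [this, ← Measure.map_map (by fun_prop) (by fun_prop), hμ, gaussianReal_map_const_mul]
    congr 1
    · simp
    · ext
      have := (hσ0 k).ne'
      simp [Real.coe_toNNReal _ (sq_nonneg (σ k))]
      field_simp
  have horth : ∀ x : ι → ℝ, (μ.map D).real (orthant fun k => (σ k)⁻¹ * x k) = μ.real (orthant x) := by
    intro x
    rw [map_measureReal_apply hDm (measurableSet_orthant _)]
    congr 1
    ext z
    simp only [orthant, Set.mem_preimage, Set.mem_ofPred_eq, hD]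
    exact forall_congr' fun k => by
      rw [mul_le_mul_iff_right₀ (inv_pos.2 (hσ0 k))]
  -- After standardization the layer has width `ε / σ k` in coordinate `k`, at most `ε / s`.
  have h := real_orthant_sub_le_of_standard hst (fun k => (σ k)⁻¹ * y k) (ε := s⁻¹ * ε)
    (by positivity) hℓ hcard
  rw [horth y] at h
  refine le_trans (sub_le_sub_right ?_ _) (h.trans_eq (by ring))
  rw [← horth]
  refine measureReal_mono fun z hz k => (hz k).trans ?_
  change (σ k)⁻¹ * (y k + ε) ≤ (σ k)⁻¹ * y k + s⁻¹ * ε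
  rw [mul_add]
  gcongr
  exact hσ k

end Nazarov

/-! ### Smooth cutoffs -/

section Cutoff

/-- `g` is a smooth cutoff, equal to `1` on `(-∞, 0]` and to `0` on `[1, ∞)`, whose first three
derivatives `g₁`, `g₂`, `g₃` are bounded by `C`. -/
structure IsCutoff (g g₁ g₂ g₃ : ℝ → ℝ) (C : ℝ) : Prop where
  nonneg : ∀ x, 0 ≤ g x
  le_one : ∀ x, g x ≤ 1
  eq_one : ∀ x ≤ 0, g x = 1
  eq_zero : ∀ x, 1 ≤ x → g x = 0
  deriv₁ : ∀ x, HasDerivAt g (g₁ x) x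
  deriv₂ : ∀ x, HasDerivAt g₁ (g₂ x) x
  deriv₃ : ∀ x, HasDerivAt g₂ (g₃ x) x
  bound₁ : ∀ x, |g₁ x| ≤ C
  bound₂ : ∀ x, |g₂ x| ≤ C
  bound₃ : ∀ x, |g₃ x| ≤ C
  supp₁ : ∀ x ∉ Set.Icc (0 : ℝ) 1, g₁ x = 0
  supp₂ : ∀ x ∉ Set.Icc (0 : ℝ) 1, g₂ x = 0
  supp₃ : ∀ x ∉ Set.Icc (0 : ℝ) 1, g₃ x = 0

lemma deriv_eq_zero_off_Icc {f : ℝ → ℝ} (h : ∀ x ∉ Set.Icc (0 : ℝ) 1, f x = 0) :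
    ∀ x ∉ Set.Icc (0 : ℝ) 1, deriv f x = 0 := by
  intro x hx
  have h1 : f =ᶠ[nhds x] fun _ => 0 := by
    filter_upwards [isClosed_Icc.isOpen_compl.mem_nhds hx] with z hz using h z hz
  rw [h1.deriv_eq]; simp

lemma exists_bound_of_continuous_of_supp {f : ℝ → ℝ} (hf : Continuous f)
    (h : ∀ x ∉ Set.Icc (0 : ℝ) 1, f x = 0) : ∃ C, ∀ x, |f x| ≤ C := by
  obtain ⟨C, hC⟩ := isCompact_Icc.exists_bound_of_continuousOn (s := Set.Icc (0 : ℝ) 1)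
    hf.continuousOn
  refine ⟨max C 0, fun x => ?_⟩
  by_cases hx : x ∈ Set.Icc (0 : ℝ) 1
  · exact (hC x hx).trans (le_max_left _ _)
  · simp [h x hx]

lemma exists_isCutoff : ∃ (g g₁ g₂ g₃ : ℝ → ℝ) (C : ℝ), 0 < C ∧ IsCutoff g g₁ g₂ g₃ C := by
  set g : ℝ → ℝ := fun x => 1 - Real.smoothTransition x with hg
  have hsm : ContDiff ℝ 4 g := contDiff_const.sub Real.smoothTransition.contDiff
  have h1 : ContDiff ℝ 3 (deriv g) := ContDiff.deriv' (n := 3) (by exact_mod_cast hsm)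
  have h2 : ContDiff ℝ 2 (deriv (deriv g)) := ContDiff.deriv' (n := 2) (by exact_mod_cast h1)
  have h3 : ContDiff ℝ 1 (deriv (deriv (deriv g))) := ContDiff.deriv' (n := 1) (by exact_mod_cast h2)
  have s1 : ∀ x ∉ Set.Icc (0 : ℝ) 1, deriv g x = 0 := by
    intro x hx
    rw [Set.mem_Icc, not_and_or, not_le, not_le] at hx
    rcases hx with hx | hx
    · have : g =ᶠ[nhds x] fun _ => 1 := by
        filter_upwards [Iio_mem_nhds hx] with z hz
        simp [hg, Real.smoothTransition.zero_of_nonpos (le_of_lt hz)]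
      rw [this.deriv_eq]; simp
    · have : g =ᶠ[nhds x] fun _ => 0 := by
        filter_upwards [Ioi_mem_nhds hx] with z hz
        simp [hg, Real.smoothTransition.one_of_one_le (le_of_lt hz)]
      rw [this.deriv_eq]; simp
  have s2 := deriv_eq_zero_off_Icc s1
  have s3 := deriv_eq_zero_off_Icc s2
  obtain ⟨C1, hC1⟩ := exists_bound_of_continuous_of_supp h1.continuous s1
  obtain ⟨C2, hC2⟩ := exists_bound_of_continuous_of_supp h2.continuous s2
  obtain ⟨C3, hC3⟩ := exists_bound_of_continuous_of_supp h3.continuous s3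
  refine ⟨g, deriv g, deriv (deriv g), deriv (deriv (deriv g)), max (max C1 C2) (max C3 1),
    by positivity, ?_⟩
  exact
    { nonneg := fun x => by simp [hg, Real.smoothTransition.le_one]
      le_one := fun x => by simp [hg, Real.smoothTransition.nonneg]
      eq_one := fun x hx => by simp [hg, Real.smoothTransition.zero_of_nonpos hx]
      eq_zero := fun x hx => by simp [hg, Real.smoothTransition.one_of_one_le hx]
      deriv₁ := fun x => (hsm.differentiable (by norm_num) x).hasDerivAt
      deriv₂ := fun x => (h1.differentiable (by norm_num) x).hasDerivAt
      deriv₃ := fun x => (h2.differentiable (by norm_num) x).hasDerivAt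
      bound₁ := fun x => (hC1 x).trans (by simp)
      bound₂ := fun x => (hC2 x).trans (by simp)
      bound₃ := fun x => (hC3 x).trans (by simp)
      supp₁ := s1
      supp₂ := s2
      supp₃ := s3 }

end Cutoff

/-! ### Third-order Taylor remainder -/

section Taylor

lemma abs_le_of_hasDerivAt_of_eq_zero {u u' : ℝ → ℝ} {B : ℝ} (hu : ∀ t, HasDerivAt u (u' t) t)
    (h0 : u 0 = 0) (hB : ∀ t ∈ Set.Icc (0 : ℝ) 1, |u' t| ≤ B) :
    ∀ t ∈ Set.Icc (0 : ℝ) 1, |u t| ≤ B := by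
  intro t ht
  have h := norm_image_sub_le_of_norm_deriv_le_segment' (f := u) (f' := u') (a := 0) (b := 1)
    (C := B) (fun x _ => (hu x).hasDerivWithinAt) (fun x hx => hB x ⟨hx.1, hx.2.le⟩) t ht
  rw [h0, sub_zero, sub_zero] at h
  have hB0 : 0 ≤ B := (abs_nonneg _).trans (hB 0 (by simp))
  exact h.trans (mul_le_of_le_one_right hB0 ht.2)

/-- Three applications of the mean value inequality; the factor `1/6` is not needed. -/
lemma abs_sub_taylor_le {h h₁ h₂ h₃ : ℝ → ℝ} {B : ℝ} (d₁ : ∀ t, HasDerivAt h (h₁ t) t)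
    (d₂ : ∀ t, HasDerivAt h₁ (h₂ t) t) (d₃ : ∀ t, HasDerivAt h₂ (h₃ t) t)
    (hB : ∀ t ∈ Set.Icc (0 : ℝ) 1, |h₃ t| ≤ B) :
    |h 1 - h 0 - h₁ 0 - h₂ 0 / 2| ≤ B := by
  have k2 := abs_le_of_hasDerivAt_of_eq_zero (u := fun t => h₂ t - h₂ 0)
    (fun t => (d₃ t).sub_const _) (by simp) hB
  have k1 := abs_le_of_hasDerivAt_of_eq_zero (u := fun t => h₁ t - h₁ 0 - t * h₂ 0)
    (u' := fun t => h₂ t - h₂ 0)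
    (fun t => (((d₂ t).sub_const (h₁ 0)).sub ((hasDerivAt_id t).mul_const (h₂ 0))).congr_deriv
      (by simp))
    (by simp) k2
  have k0 := abs_le_of_hasDerivAt_of_eq_zero
    (u := fun t => h t - h 0 - t * h₁ 0 - t ^ 2 / 2 * h₂ 0)
    (u' := fun t => h₁ t - h₁ 0 - t * h₂ 0)
    (fun t => by
      refine ((((d₁ t).sub_const (h 0)).sub ((hasDerivAt_id t).mul_const (h₁ 0))).sub
        ((((hasDerivAt_id t).pow 2).div_const 2).mul_const (h₂ 0))).congr_deriv ?_
      simp) (by simp) k1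
  have := k0 1 (by simp)
  convert this using 2
  ring

end Taylor

/-! ### The smooth maximum -/

section SmoothMax

variable {ι : Type*} [Fintype ι]

/-- `∑_k exp (β (w_k - y_k))`. -/
def expSum (β : ℝ) (y w : ι → ℝ) : ℝ := ∑ k, Real.exp (β * (w k - y k))

/-- The smooth maximum `β⁻¹ log ∑_k exp (β (w_k - y_k))` of the `w_k - y_k`. -/
def smoothMax (β : ℝ) (y w : ι → ℝ) : ℝ := Real.log (expSum β y w) / β

/-- The weights that the smooth maximum gives to the coordinates. -/
def softWeight (β : ℝ) (y w : ι → ℝ) (k : ι) : ℝ := Real.exp (β * (w k - y k)) / expSum β y w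

/-- The moments of `v` under the soft weights at `w`. -/
def softMoment (β : ℝ) (y w v : ι → ℝ) (r : ℕ) : ℝ := ∑ k, softWeight β y w k * v k ^ r

/-- The third absolute moment of `v` under the soft weights at `w`. -/
def softAbsCube (β : ℝ) (y w v : ι → ℝ) : ℝ := ∑ k, softWeight β y w k * |v k| ^ 3

lemma expSum_add_le {β : ℝ} (hβ : 0 < β) (y w v : ι → ℝ) :
    expSum β y (w + v) ≤ Real.exp (β * ‖v‖) * expSum β y w := by
  rw [expSum, expSum, Finset.mul_sum]
  refine Finset.sum_le_sum fun k _ => ?_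
  rw [← Real.exp_add]
  refine Real.exp_le_exp.2 ?_
  have := (le_abs_self _).trans (norm_le_pi_norm v k)
  simp only [Pi.add_apply]
  nlinarith

section Nonempty

variable [Nonempty ι]

lemma expSum_pos (β : ℝ) (y w : ι → ℝ) : 0 < expSum β y w :=
  Finset.sum_pos (fun _ _ => Real.exp_pos _) Finset.univ_nonempty

lemma softWeight_pos (β : ℝ) (y w : ι → ℝ) (k : ι) : 0 < softWeight β y w k :=
  div_pos (Real.exp_pos _) (expSum_pos β y w)

lemma sum_softWeight (β : ℝ) (y w : ι → ℝ) : ∑ k, softWeight β y w k = 1 := by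
  simp only [softWeight, ← Finset.sum_div]
  exact div_self (expSum_pos β y w).ne'

lemma hasDerivAt_expSum (β : ℝ) (y w v : ι → ℝ) (t : ℝ) :
    HasDerivAt (fun t : ℝ => expSum β y (w + t • v))
      (β * softMoment β y (w + t • v) v 1 * expSum β y (w + t • v)) t := by
  have h : ∀ k ∈ Finset.univ, HasDerivAt (fun t : ℝ => Real.exp (β * ((w + t • v) k - y k)))
      (Real.exp (β * ((w + t • v) k - y k)) * (β * v k)) t := by
    intro k _
    refine HasDerivAt.exp ?_
    have := ((((hasDerivAt_id t).mul_const (v k)).const_add (w k)).sub_const (y k)).const_mul β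
    simpa using this
  have h2 := HasDerivAt.fun_sum h
  refine h2.congr_deriv ?_
  rw [softMoment, Finset.mul_sum, Finset.sum_mul]
  refine Finset.sum_congr rfl fun k _ => ?_
  have := (expSum_pos β y (w + t • v)).ne'
  rw [softWeight]
  field_simp

lemma hasDerivAt_smoothMax {β : ℝ} (hβ : β ≠ 0) (y w v : ι → ℝ) (t : ℝ) :
    HasDerivAt (fun t : ℝ => smoothMax β y (w + t • v)) (softMoment β y (w + t • v) v 1) t := by
  have hne := (expSum_pos β y (w + t • v)).ne'
  refine (((hasDerivAt_expSum β y w v t).log hne).div_const β).congr_deriv ?_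
  field_simp

/-- The soft weights form a Gibbs measure tilted along `v`, so differentiating a moment gives `β`
times a covariance with `v`. Iterating this yields every derivative of the smooth maximum. -/
lemma hasDerivAt_softMoment (β : ℝ) (y w v : ι → ℝ) (r : ℕ) (t : ℝ) :
    HasDerivAt (fun t : ℝ => softMoment β y (w + t • v) v r)
      (β * (softMoment β y (w + t • v) v (r + 1) -
        softMoment β y (w + t • v) v r * softMoment β y (w + t • v) v 1)) t := by
  have hne := (expSum_pos β y (w + t • v)).ne'
  have h : ∀ k ∈ Finset.univ, HasDerivAt (fun t : ℝ => softWeight β y (w + t • v) k * v k ^ r)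
      (β * (softWeight β y (w + t • v) k * v k ^ (r + 1) -
        softWeight β y (w + t • v) k * v k ^ r * softMoment β y (w + t • v) v 1)) t := by
    intro k _
    have h1 : HasDerivAt (fun t : ℝ => Real.exp (β * ((w + t • v) k - y k)))
        (Real.exp (β * ((w + t • v) k - y k)) * (β * v k)) t := by
      refine HasDerivAt.exp ?_
      have := ((((hasDerivAt_id t).mul_const (v k)).const_add (w k)).sub_const (y k)).const_mul β
      simpa using this
    refine ((h1.div (hasDerivAt_expSum β y w v t) hne).mul_const (v k ^ r)).congr_deriv ?_
    rw [softWeight]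
    field_simp
    ring
  refine (HasDerivAt.fun_sum h).congr_deriv ?_
  rw [← Finset.mul_sum, Finset.sum_sub_distrib, ← Finset.sum_mul]
  rfl

lemma le_smoothMax {β : ℝ} (hβ : 0 < β) (y w : ι → ℝ) (k : ι) : w k - y k ≤ smoothMax β y w := by
  rw [smoothMax, le_div_iff₀ hβ, mul_comm, Real.le_log_iff_exp_le (expSum_pos β y w)]
  exact Finset.single_le_sum (f := fun k => Real.exp (β * (w k - y k)))
    (fun _ _ => (Real.exp_pos _).le) (Finset.mem_univ k)

lemma smoothMax_le {β : ℝ} (hβ : 0 < β) (y w : ι → ℝ) {c : ℝ} (h : ∀ k, w k - y k ≤ c) :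
    smoothMax β y w ≤ c + Real.log (Fintype.card ι) / β := by
  have hc : (0 : ℝ) < Fintype.card ι := by exact_mod_cast Fintype.card_pos
  rw [smoothMax, div_le_iff₀ hβ, add_mul, div_mul_cancel₀ _ hβ.ne',
    Real.log_le_iff_le_exp (expSum_pos β y w), Real.exp_add, Real.exp_log hc]
  calc expSum β y w ≤ ∑ _k : ι, Real.exp (c * β) :=
        Finset.sum_le_sum fun k _ => Real.exp_le_exp.2 (by nlinarith [h k])
    _ = _ := by simp [mul_comm]

lemma smoothMax_add_le {β : ℝ} (hβ : 0 < β) (y w v : ι → ℝ) :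
    smoothMax β y (w + v) ≤ smoothMax β y w + ‖v‖ := by
  rw [smoothMax, smoothMax, div_le_iff₀ hβ, add_mul, div_mul_cancel₀ _ hβ.ne',
    Real.log_le_iff_le_exp (expSum_pos _ _ _), Real.exp_add, Real.exp_log (expSum_pos _ _ _),
    mul_comm, mul_comm ‖v‖]
  exact expSum_add_le hβ y w v

lemma smoothMax_sub_le {β : ℝ} (hβ : 0 < β) (y w v : ι → ℝ) :
    smoothMax β y w ≤ smoothMax β y (w + v) + ‖v‖ := by
  simpa using smoothMax_add_le hβ y (w + v) (-v)

/-- Numerator and denominator each change by at most a factor `exp (β ‖v‖)`. This stability lets the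
remainder along a segment be measured by the weights at its starting point. -/
lemma softWeight_add_le {β : ℝ} (hβ : 0 < β) (y w v : ι → ℝ) (k : ι) :
    softWeight β y (w + v) k ≤ Real.exp (2 * (β * ‖v‖)) * softWeight β y w k := by
  have h1 := expSum_add_le hβ y (w + v) (-v)
  simp only [add_neg_cancel_right, norm_neg] at h1
  have h2 : Real.exp (β * ((w + v) k - y k)) ≤ Real.exp (β * ‖v‖) * Real.exp (β * (w k - y k)) := by
    rw [← Real.exp_add]
    refine Real.exp_le_exp.2 ?_
    have := (le_abs_self _).trans (norm_le_pi_norm v k)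
    simp only [Pi.add_apply]
    nlinarith
  have hp := expSum_pos β y w
  have hp' := expSum_pos β y (w + v)
  rw [softWeight, softWeight, div_le_iff₀ hp', two_mul, Real.exp_add]
  calc Real.exp (β * ((w + v) k - y k))
      ≤ Real.exp (β * ‖v‖) * Real.exp (β * (w k - y k)) := h2
    _ = Real.exp (β * ‖v‖) * (Real.exp (β * (w k - y k)) / expSum β y w) * expSum β y w := by
        field_simp
    _ ≤ Real.exp (β * ‖v‖) * (Real.exp (β * (w k - y k)) / expSum β y w) *
        (Real.exp (β * ‖v‖) * expSum β y (w + v)) := by gcongr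
    _ = _ := by ring

lemma softAbsCube_nonneg (β : ℝ) (y w v : ι → ℝ) : 0 ≤ softAbsCube β y w v :=
  Finset.sum_nonneg fun k _ => mul_nonneg (softWeight_pos β y w k).le (by positivity)

lemma softAbsCube_le_norm (β : ℝ) (y w v : ι → ℝ) : softAbsCube β y w v ≤ ‖v‖ ^ 3 := by
  calc softAbsCube β y w v ≤ ∑ k, softWeight β y w k * ‖v‖ ^ 3 := by
        refine Finset.sum_le_sum fun k _ => ?_
        have := (softWeight_pos β y w k).le
        gcongr
        exact norm_le_pi_norm v k
    _ = _ := by rw [← Finset.sum_mul, sum_softWeight, one_mul]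

lemma abs_softMoment_three_le (β : ℝ) (y w v : ι → ℝ) :
    |softMoment β y w v 3| ≤ softAbsCube β y w v := by
  refine (Finset.abs_sum_le_sum_abs _ _).trans (Finset.sum_le_sum fun k _ => ?_)
  rw [abs_mul, abs_of_pos (softWeight_pos β y w k), abs_pow]

lemma sq_softMoment_one_le (β : ℝ) (y w v : ι → ℝ) :
    softMoment β y w v 1 ^ 2 ≤ softMoment β y w v 2 := by
  set m := softMoment β y w v 1 with hm
  have h : 0 ≤ ∑ k, softWeight β y w k * (v k - m) ^ 2 :=
    Finset.sum_nonneg fun k _ => mul_nonneg (softWeight_pos β y w k).le (sq_nonneg _)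
  have h2 : ∑ k, softWeight β y w k * (v k - m) ^ 2 =
      softMoment β y w v 2 - 2 * m * softMoment β y w v 1 + m ^ 2 * ∑ k, softWeight β y w k := by
    simp only [softMoment, Finset.mul_sum, ← Finset.sum_sub_distrib, ← Finset.sum_add_distrib]
    refine Finset.sum_congr rfl fun k _ => ?_
    ring
  rw [h2, sum_softWeight, ← hm] at h
  linarith

/-- Expand the product as a double sum over two independent soft indices and apply `a b² ≤ a³ + b³`.
-/
lemma abs_softMoment_one_mul_le (β : ℝ) (y w v : ι → ℝ) :
    |softMoment β y w v 1| * softMoment β y w v 2 ≤ 2 * softAbsCube β y w v := by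
  have hπ := fun k => (softWeight_pos β y w k).le
  have h1 : |softMoment β y w v 1| ≤ ∑ k, softWeight β y w k * |v k| := by
    refine (Finset.abs_sum_le_sum_abs _ _).trans (Finset.sum_le_sum fun k _ => ?_)
    rw [abs_mul, abs_of_nonneg (hπ k), pow_one]
  have h2 : softMoment β y w v 2 = ∑ k, softWeight β y w k * |v k| ^ 2 := by simp [softMoment]
  have h3 : 0 ≤ ∑ k, softWeight β y w k * |v k| ^ 2 :=
    Finset.sum_nonneg fun k _ => mul_nonneg (hπ k) (by positivity)
  have h4 : ∀ a b : ℝ, 0 ≤ a → 0 ≤ b → a * b ^ 2 ≤ a ^ 3 + b ^ 3 := by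
    intro a b ha hb
    rcases le_total a b with h | h
    · nlinarith [pow_nonneg ha 3, mul_le_mul_of_nonneg_right h (sq_nonneg b)]
    · have : b ^ 2 ≤ a ^ 2 := by gcongr
      nlinarith [pow_nonneg hb 3, mul_le_mul_of_nonneg_left this ha]
  calc |softMoment β y w v 1| * softMoment β y w v 2
      ≤ (∑ k, softWeight β y w k * |v k|) * ∑ k, softWeight β y w k * |v k| ^ 2 := by
        rw [h2]; gcongr
    _ = ∑ j, ∑ k, softWeight β y w j * softWeight β y w k * (|v j| * |v k| ^ 2) := by
        rw [Finset.sum_mul_sum]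
        refine Finset.sum_congr rfl fun j _ => Finset.sum_congr rfl fun k _ => by ring
    _ ≤ ∑ j, ∑ k, softWeight β y w j * softWeight β y w k * (|v j| ^ 3 + |v k| ^ 3) := by
        refine Finset.sum_le_sum fun j _ => Finset.sum_le_sum fun k _ => ?_
        exact mul_le_mul_of_nonneg_left (h4 _ _ (abs_nonneg _) (abs_nonneg _))
          (mul_nonneg (hπ j) (hπ k))
    _ = (∑ j, softWeight β y w j * |v j| ^ 3) * (∑ k, softWeight β y w k) +
        (∑ j, softWeight β y w j) * ∑ k, softWeight β y w k * |v k| ^ 3 := by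
        rw [Finset.sum_mul_sum, Finset.sum_mul_sum, ← Finset.sum_add_distrib]
        refine Finset.sum_congr rfl fun j _ => ?_
        rw [← Finset.sum_add_distrib]
        exact Finset.sum_congr rfl fun k _ => by ring
    _ = _ := by rw [sum_softWeight, softAbsCube]; ring

end Nonempty

/-- The smoothed indicator of the orthant. -/
def smoothInd (g : ℝ → ℝ) (φ β : ℝ) (y w : ι → ℝ) : ℝ := g (φ * smoothMax β y w)

/-- The first derivative of the smoothed indicator at `w` in the direction `v`. -/
def smoothInd₁ (g₁ : ℝ → ℝ) (φ β : ℝ) (y w v : ι → ℝ) : ℝ :=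
  φ * g₁ (φ * smoothMax β y w) * softMoment β y w v 1

/-- The second derivative of the smoothed indicator at `w` in the direction `v`. -/
def smoothInd₂ (g₁ g₂ : ℝ → ℝ) (φ β : ℝ) (y w v : ι → ℝ) : ℝ :=
  φ ^ 2 * g₂ (φ * smoothMax β y w) * softMoment β y w v 1 ^ 2 +
    φ * β * g₁ (φ * smoothMax β y w) * (softMoment β y w v 2 - softMoment β y w v 1 ^ 2)

/-- The third derivative of the smoothed indicator at `w` in the direction `v`. -/
def smoothInd₃ (g₁ g₂ g₃ : ℝ → ℝ) (φ β : ℝ) (y w v : ι → ℝ) : ℝ :=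
  φ ^ 3 * g₃ (φ * smoothMax β y w) * softMoment β y w v 1 ^ 3 +
    3 * φ ^ 2 * β * g₂ (φ * smoothMax β y w) *
      (softMoment β y w v 1 * (softMoment β y w v 2 - softMoment β y w v 1 ^ 2)) +
    φ * β ^ 2 * g₁ (φ * smoothMax β y w) * (softMoment β y w v 3 -
      3 * (softMoment β y w v 1 * softMoment β y w v 2) + 2 * softMoment β y w v 1 ^ 3)

/-- The remainder of the second-order expansion of the smoothed indicator. -/
def smoothIndRem (g g₁ g₂ : ℝ → ℝ) (φ β : ℝ) (y w v : ι → ℝ) : ℝ :=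
  smoothInd g φ β y (w + v) - smoothInd g φ β y w - smoothInd₁ g₁ φ β y w v -
    smoothInd₂ g₁ g₂ φ β y w v / 2

variable {g g₁ g₂ g₃ : ℝ → ℝ} {C φ β : ℝ}

lemma smoothInd₃_eq_zero (hg : IsCutoff g g₁ g₂ g₃ C) (y w v : ι → ℝ)
    (h : φ * smoothMax β y w ∉ Set.Icc (0 : ℝ) 1) : smoothInd₃ g₁ g₂ g₃ φ β y w v = 0 := by
  simp [smoothInd₃, hg.supp₁ _ h, hg.supp₂ _ h, hg.supp₃ _ h]

variable [Nonempty ι]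

/-- Every cubic combination of soft moments is dominated by the third absolute moment, and `φ ≤ β`
makes `φ β²` the dominant scale. The terms contribute `2 + 3·2 + 11 = 19`. -/
lemma abs_smoothInd₃_le (hg : IsCutoff g g₁ g₂ g₃ C) (hC : 0 < C) (hφ : 0 < φ) (hφβ : φ ≤ β)
    (y w v : ι → ℝ) :
    |smoothInd₃ g₁ g₂ g₃ φ β y w v| ≤ 19 * C * (φ * β ^ 2) * softAbsCube β y w v := by
  set m1 := softMoment β y w v 1 with hm1
  set m2 := softMoment β y w v 2 with hm2
  set m3 := softMoment β y w v 3 with hm3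
  set A := softAbsCube β y w v with hA
  set x := φ * smoothMax β y w
  have hβ : 0 < β := hφ.trans_le hφβ
  have hA0 : 0 ≤ A := softAbsCube_nonneg β y w v
  have h12 : |m1| * m2 ≤ 2 * A := abs_softMoment_one_mul_le β y w v
  have hsq : m1 ^ 2 ≤ m2 := sq_softMoment_one_le β y w v
  have h3 : |m3| ≤ A := abs_softMoment_three_le β y w v
  have hm2 : 0 ≤ m2 := (sq_nonneg _).trans hsq
  have h111 : |m1 ^ 3| ≤ 2 * A := by
    have : |m1 ^ 3| = |m1| * m1 ^ 2 := by rw [abs_pow, pow_succ', sq_abs]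
    rw [this]
    exact (mul_le_mul_of_nonneg_left hsq (abs_nonneg _)).trans h12
  have hv : |m1 * (m2 - m1 ^ 2)| ≤ 2 * A := by
    rw [abs_mul, abs_of_nonneg (sub_nonneg.2 hsq)]
    refine le_trans (mul_le_mul_of_nonneg_left ?_ (abs_nonneg _)) h12
    linarith [sq_nonneg m1]
  have h12' : |m1 * m2| ≤ 2 * A := by rwa [abs_mul, abs_of_nonneg hm2]
  have hk : |m3 - 3 * (m1 * m2) + 2 * m1 ^ 3| ≤ 11 * A := by
    rw [abs_le] at h3 h12' h111 ⊢
    constructor <;> linarith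
  have t1 : |φ ^ 3 * g₃ x * m1 ^ 3| ≤ φ * β ^ 2 * C * (2 * A) := by
    rw [abs_mul, abs_mul, abs_of_pos (by positivity : 0 < φ ^ 3)]
    have : φ ^ 3 ≤ φ * β ^ 2 := by
      rw [pow_succ']; gcongr
    gcongr
    exact hg.bound₃ x
  have t2 : |3 * φ ^ 2 * β * g₂ x * (m1 * (m2 - m1 ^ 2))| ≤ 3 * (φ * β ^ 2) * C * (2 * A) := by
    rw [abs_mul, abs_mul, abs_of_pos (by positivity : 0 < 3 * φ ^ 2 * β)]
    have : 3 * φ ^ 2 * β ≤ 3 * (φ * β ^ 2) := by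
      nlinarith [mul_le_mul_of_nonneg_left hφβ (mul_pos hφ hβ).le]
    gcongr
    exact hg.bound₂ x
  have t3 : |φ * β ^ 2 * g₁ x * (m3 - 3 * (m1 * m2) + 2 * m1 ^ 3)| ≤
      φ * β ^ 2 * C * (11 * A) := by
    rw [abs_mul, abs_mul, abs_of_pos (by positivity : 0 < φ * β ^ 2)]
    gcongr
    exact hg.bound₁ x
  calc |smoothInd₃ g₁ g₂ g₃ φ β y w v|
      ≤ φ * β ^ 2 * C * (2 * A) + 3 * (φ * β ^ 2) * C * (2 * A) + φ * β ^ 2 * C * (11 * A) :=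
        (abs_add_three _ _ _).trans (add_le_add (add_le_add t1 t2) t3)
    _ = _ := by ring

lemma abs_smoothIndRem_le (hg : IsCutoff g g₁ g₂ g₃ C) (hβ : β ≠ 0) (y w v : ι → ℝ) {B : ℝ}
    (hB : ∀ t ∈ Set.Icc (0 : ℝ) 1, |smoothInd₃ g₁ g₂ g₃ φ β y (w + t • v) v| ≤ B) :
    |smoothIndRem g g₁ g₂ φ β y w v| ≤ B := by
  have hF := hasDerivAt_smoothMax hβ y w v
  have hm := hasDerivAt_softMoment β y w v
  have hc : ∀ {f f' : ℝ → ℝ}, (∀ x, HasDerivAt f (f' x) x) → ∀ t : ℝ,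
      HasDerivAt (fun t : ℝ => f (φ * smoothMax β y (w + t • v)))
        (f' (φ * smoothMax β y (w + t • v)) * (φ * softMoment β y (w + t • v) v 1)) t :=
    fun h t => (h _).comp t ((hF t).const_mul φ)
  have d1 : ∀ t : ℝ, HasDerivAt (fun t : ℝ => smoothInd g φ β y (w + t • v))
      (smoothInd₁ g₁ φ β y (w + t • v) v) t := fun t =>
    (hc hg.deriv₁ t).congr_deriv (by rw [smoothInd₁]; ring)
  have d2 : ∀ t : ℝ, HasDerivAt (fun t : ℝ => smoothInd₁ g₁ φ β y (w + t • v) v)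
      (smoothInd₂ g₁ g₂ φ β y (w + t • v) v) t := fun t =>
    (((hc hg.deriv₂ t).const_mul φ).mul (hm 1 t)).congr_deriv (by rw [smoothInd₂]; ring)
  have d3 : ∀ t : ℝ, HasDerivAt (fun t : ℝ => smoothInd₂ g₁ g₂ φ β y (w + t • v) v)
      (smoothInd₃ g₁ g₂ g₃ φ β y (w + t • v) v) t := fun t =>
    ((((hc hg.deriv₃ t).const_mul (φ ^ 2)).mul ((hm 1 t).pow 2)).add
      (((hc hg.deriv₂ t).const_mul (φ * β)).mul ((hm 2 t).sub ((hm 1 t).pow 2)))).congr_deriv (by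
        rw [smoothInd₃]
        simp only [Pi.pow_apply, Pi.sub_apply]
        push_cast
        ring)
  have := abs_sub_taylor_le d1 d2 d3 hB
  simpa [smoothIndRem] using this

lemma abs_smoothIndRem_le_norm (hg : IsCutoff g g₁ g₂ g₃ C) (hC : 0 < C) (hφ : 0 < φ)
    (hφβ : φ ≤ β) (y w v : ι → ℝ) :
    |smoothIndRem g g₁ g₂ φ β y w v| ≤ 38 * C * (φ * β ^ 2) * ‖v‖ ^ 3 := by
  have hβ : 0 < β := hφ.trans_le hφβ
  refine abs_smoothIndRem_le hg hβ.ne' y w v fun t _ =>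
    (abs_smoothInd₃_le hg hC hφ hφβ y _ v).trans ?_
  have h := softAbsCube_le_norm β y (w + t • v) v
  have h0 := softAbsCube_nonneg β y (w + t • v) v
  gcongr
  norm_num

/-- The set where the smooth maximum is within `O(1/φ)` of zero. -/
def strip (φ β : ℝ) (y : ι → ℝ) (c : ℝ) : Set (ι → ℝ) :=
  {w | -c ≤ φ * smoothMax β y w ∧ φ * smoothMax β y w ≤ 1 + c}

/-- A short increment moves `φ F` by at most `1/4` and the soft weights by at most `exp (1/2) ≤ 2`.
Hence the third derivative vanishes along the whole segment unless `w` is in the strip, and there it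
is controlled by the weights at `w`. -/
lemma abs_smoothIndRem_le_of_small (hg : IsCutoff g g₁ g₂ g₃ C) (hC : 0 < C) (hφ : 0 < φ)
    (hφβ : φ ≤ β) (y w v : ι → ℝ) (hv : β * ‖v‖ ≤ 1 / 4) :
    |smoothIndRem g g₁ g₂ φ β y w v| ≤
      38 * C * (φ * β ^ 2) * ((strip φ β y 1).indicator 1 w * softAbsCube β y w v) := by
  have hβ : 0 < β := hφ.trans_le hφβ
  refine abs_smoothIndRem_le hg hβ.ne' y w v fun t ht => ?_
  have htv : ‖t • v‖ ≤ ‖v‖ := by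
    rw [norm_smul, Real.norm_eq_abs, abs_of_nonneg ht.1]
    exact mul_le_of_le_one_left (norm_nonneg _) ht.2
  have hβv : β * ‖t • v‖ ≤ 1 / 4 := (mul_le_mul_of_nonneg_left htv hβ.le).trans hv
  have hφv : φ * ‖t • v‖ ≤ 1 / 4 := (mul_le_mul_of_nonneg_right hφβ (norm_nonneg _)).trans hβv
  by_cases hs : φ * smoothMax β y (w + t • v) ∈ Set.Icc (0 : ℝ) 1
  · have hw : w ∈ strip φ β y 1 := by
      have h1 := mul_le_mul_of_nonneg_left (smoothMax_add_le hβ y w (t • v)) hφ.le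
      have h2 := mul_le_mul_of_nonneg_left (smoothMax_sub_le hβ y w (t • v)) hφ.le
      have := hs.1
      have := hs.2
      constructor <;> linarith
    refine (abs_smoothInd₃_le hg hC hφ hφβ y _ v).trans ?_
    rw [Set.indicator_of_mem hw, Pi.one_apply, one_mul]
    have h1 : softAbsCube β y (w + t • v) v ≤ 2 * softAbsCube β y w v := by
      rw [softAbsCube, softAbsCube, Finset.mul_sum]
      refine Finset.sum_le_sum fun k _ => ?_
      rw [← mul_assoc]
      refine mul_le_mul_of_nonneg_right ?_ (by positivity)
      refine (softWeight_add_le hβ y w (t • v) k).trans ?_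
      refine mul_le_mul_of_nonneg_right ?_ (softWeight_pos β y w k).le
      calc Real.exp (2 * (β * ‖t • v‖)) ≤ Real.exp (1 / 2) := Real.exp_le_exp.2 (by linarith)
        _ ≤ 2 := by
          have h := Real.exp_one_lt_d9
          have h2 : Real.exp 1 = Real.exp (1 / 2) * Real.exp (1 / 2) := by
            rw [← Real.exp_add]; norm_num
          nlinarith [Real.exp_pos (1 / 2)]
    calc 19 * C * (φ * β ^ 2) * softAbsCube β y (w + t • v) v
        ≤ 19 * C * (φ * β ^ 2) * (2 * softAbsCube β y w v) := by gcongr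
      _ = _ := by ring
  · rw [smoothInd₃_eq_zero hg y _ v hs, abs_zero]
    have h0 := softAbsCube_nonneg β y w v
    have : 0 ≤ (strip φ β y 1).indicator (1 : (ι → ℝ) → ℝ) w :=
      Set.indicator_nonneg (fun _ _ => zero_le_one) w
    positivity

end SmoothMax

/-! ### Lindeberg's exchange argument for orthants -/

section Lindeberg

variable {ι : Type*} [Fintype ι] {g g₁ g₂ g₃ : ℝ → ℝ} {C φ β : ℝ}

lemma IsCutoff.continuous (hg : IsCutoff g g₁ g₂ g₃ C) : Continuous g :=
  continuous_iff_continuousAt.2 fun x => (hg.deriv₁ x).continuousAt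

lemma smoothInd_mem_Icc (hg : IsCutoff g g₁ g₂ g₃ C) (φ β : ℝ) (y w : ι → ℝ) :
    smoothInd g φ β y w ∈ Set.Icc (0 : ℝ) 1 := ⟨hg.nonneg _, hg.le_one _⟩

@[fun_prop]
lemma continuous_expSum (β : ℝ) (y : ι → ℝ) : Continuous (expSum β y) := by
  unfold expSum; fun_prop

section Continuity

variable [Nonempty ι]

@[fun_prop]
lemma continuous_smoothMax (β : ℝ) (y : ι → ℝ) : Continuous (smoothMax β y) :=
  ((continuous_expSum β y).log fun w => (expSum_pos β y w).ne').div_const β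

lemma continuous_smoothInd (hg : IsCutoff g g₁ g₂ g₃ C) (φ β : ℝ) (y : ι → ℝ) :
    Continuous (smoothInd g φ β y) :=
  hg.continuous.comp (continuous_const.mul (continuous_smoothMax β y))

lemma integrable_smoothInd (hg : IsCutoff g g₁ g₂ g₃ C) (φ β : ℝ) (y w : ι → ℝ)
    (μ : Measure (ι → ℝ)) [IsFiniteMeasure μ] :
    Integrable (fun v => smoothInd g φ β y (w + v)) μ :=
  Integrable.of_mem_Icc 0 1
    ((continuous_smoothInd hg φ β y).comp (continuous_const.add continuous_id)).aemeasurable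
    (Filter.Eventually.of_forall fun _ => smoothInd_mem_Icc hg φ β y _)

lemma measurableSet_strip (φ β : ℝ) (y : ι → ℝ) (c : ℝ) : MeasurableSet (strip φ β y c) := by
  have hm : Measurable fun w => φ * smoothMax β y w := by fun_prop
  have h : strip φ β y c =
      {w | -c ≤ φ * smoothMax β y w} ∩ {w | φ * smoothMax β y w ≤ 1 + c} := rfl
  rw [h]
  exact (measurableSet_le measurable_const hm).inter (measurableSet_le hm measurable_const)

end Continuity

/-- Two measures with finite third moments and the same first and second moments. -/
structure MomentsMatch (μ ν : Measure (ι → ℝ)) : Prop where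
  memLp_left : MemLp id 3 μ
  memLp_right : MemLp id 3 ν
  mean : ∀ k, ∫ v, v k ∂μ = ∫ v, v k ∂ν
  second : ∀ j k, ∫ v, v j * v k ∂μ = ∫ v, v j * v k ∂ν

section Moments

variable {μ : Measure (ι → ℝ)}

lemma integrable_norm_cube (hμ : MemLp id 3 μ) : Integrable (fun v => ‖v‖ ^ 3) μ := by
  have := hμ.integrable_norm_pow (p := 3) (by norm_num)
  simpa using this

lemma integrable_abs_cube (hμ : MemLp id 3 μ) (k : ι) : Integrable (fun v => |v k| ^ 3) μ := by
  have := (hμ.eval k).integrable_norm_pow (p := 3) (by norm_num)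
  simpa using this

variable [IsProbabilityMeasure μ]

lemma integrable_eval_of_memLp (hμ : MemLp id 3 μ) (k : ι) : Integrable (fun v => v k) μ :=
  (hμ.eval k).integrable (by norm_num)

lemma integrable_eval_mul_eval (hμ : MemLp id 3 μ) (j k : ι) :
    Integrable (fun v => v j * v k) μ :=
  MemLp.integrable_mul (p := 2) (q := 2) ((hμ.eval j).mono_exponent (by norm_num))
    ((hμ.eval k).mono_exponent (by norm_num))

lemma smoothInd₁_eq_sum (g₁ : ℝ → ℝ) (φ β : ℝ) (y w v : ι → ℝ) :
    smoothInd₁ g₁ φ β y w v =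
      ∑ k, φ * g₁ (φ * smoothMax β y w) * softWeight β y w k * v k := by
  rw [smoothInd₁, softMoment, Finset.mul_sum]
  exact Finset.sum_congr rfl fun k _ => by ring

/-- The second-order term is a quadratic form in `v`, so its expectation depends only on second
moments. -/
lemma exists_smoothInd₂_eq_sum (g₁ g₂ : ℝ → ℝ) (φ β : ℝ) (y w : ι → ℝ) :
    ∃ a : ι → ι → ℝ, ∀ v, smoothInd₂ g₁ g₂ φ β y w v = ∑ j, ∑ k, a j k * (v j * v k) := by
  classical
  set x := φ * smoothMax β y w with hx
  set π := softWeight β y w with hπ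
  refine ⟨fun j k => (φ ^ 2 * g₂ x - φ * β * g₁ x) * (π j * π k) +
    if j = k then φ * β * g₁ x * π j else 0, fun v => ?_⟩
  have h1 : softMoment β y w v 1 ^ 2 = ∑ j, ∑ k, π j * π k * (v j * v k) := by
    rw [sq, softMoment, Finset.sum_mul_sum]
    exact Finset.sum_congr rfl fun j _ => Finset.sum_congr rfl fun k _ => by rw [← hπ]; ring
  simp only [add_mul, Finset.sum_add_distrib, ite_mul, zero_mul, Finset.sum_ite_eq,
    Finset.mem_univ, if_true, mul_assoc _ (π _ * π _), ← Finset.mul_sum]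
  rw [← h1, smoothInd₂, ← hx]
  have h2 : ∑ i, φ * β * g₁ x * π i * (v i * v i) = φ * β * g₁ x * softMoment β y w v 2 := by
    rw [softMoment, Finset.mul_sum]
    exact Finset.sum_congr rfl fun k _ => by rw [← hπ]; ring
  rw [h2]
  ring

lemma integrable_smoothInd₁ (hμ : MemLp id 3 μ) (y w : ι → ℝ) :
    Integrable (smoothInd₁ g₁ φ β y w) μ := by
  simp only [funext (smoothInd₁_eq_sum g₁ φ β y w)]
  exact integrable_finsetSum _ fun k _ => (integrable_eval_of_memLp hμ k).const_mul _

lemma integrable_smoothInd₂ (hμ : MemLp id 3 μ) (y w : ι → ℝ) :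
    Integrable (smoothInd₂ g₁ g₂ φ β y w) μ := by
  obtain ⟨a, ha⟩ := exists_smoothInd₂_eq_sum g₁ g₂ φ β y w
  simp only [funext ha]
  exact integrable_finsetSum _ fun j _ => integrable_finsetSum _ fun k _ =>
    (integrable_eval_mul_eval hμ j k).const_mul _

variable {ν : Measure (ι → ℝ)} [IsProbabilityMeasure ν]

lemma MomentsMatch.integral_smoothInd₁_eq (h : MomentsMatch μ ν) (y w : ι → ℝ) :
    ∫ v, smoothInd₁ g₁ φ β y w v ∂μ = ∫ v, smoothInd₁ g₁ φ β y w v ∂ν := by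
  simp only [smoothInd₁_eq_sum]
  rw [integral_finsetSum _ fun k _ => (integrable_eval_of_memLp h.memLp_left k).const_mul _,
    integral_finsetSum _ fun k _ => (integrable_eval_of_memLp h.memLp_right k).const_mul _]
  refine Finset.sum_congr rfl fun k _ => ?_
  rw [integral_const_mul, integral_const_mul, h.mean]

lemma MomentsMatch.integral_smoothInd₂_eq (h : MomentsMatch μ ν) (y w : ι → ℝ) :
    ∫ v, smoothInd₂ g₁ g₂ φ β y w v ∂μ = ∫ v, smoothInd₂ g₁ g₂ φ β y w v ∂ν := by
  obtain ⟨a, ha⟩ := exists_smoothInd₂_eq_sum g₁ g₂ φ β y w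
  simp only [ha]
  have hL := fun j k => (integrable_eval_mul_eval h.memLp_left j k).const_mul (a j k)
  have hR := fun j k => (integrable_eval_mul_eval h.memLp_right j k).const_mul (a j k)
  rw [integral_finsetSum _ fun j _ => integrable_finsetSum _ fun k _ => hL j k,
    integral_finsetSum _ fun j _ => integrable_finsetSum _ fun k _ => hR j k]
  refine Finset.sum_congr rfl fun j _ => ?_
  rw [integral_finsetSum _ fun k _ => hL j k, integral_finsetSum _ fun k _ => hR j k]
  refine Finset.sum_congr rfl fun k _ => ?_
  rw [integral_const_mul, integral_const_mul, h.second]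

end Moments

/-- `E[‖v‖³ 1{β ‖v‖ > 1/4}]`. -/
def tailCube (β : ℝ) (μ : Measure (ι → ℝ)) : ℝ :=
  ∫ v, {v : ι → ℝ | 1 / 4 < β * ‖v‖}.indicator (fun v => ‖v‖ ^ 3) v ∂μ

lemma measurableSet_far (β : ℝ) : MeasurableSet {v : ι → ℝ | 1 / 4 < β * ‖v‖} :=
  measurableSet_lt measurable_const (by fun_prop)

variable [Nonempty ι] {μ : Measure (ι → ℝ)} [IsProbabilityMeasure μ]

lemma integrable_smoothIndRem (hg : IsCutoff g g₁ g₂ g₃ C) (hμ : MemLp id 3 μ) (y w : ι → ℝ) :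
    Integrable (smoothIndRem g g₁ g₂ φ β y w) μ :=
  (((integrable_smoothInd hg φ β y w μ).sub (integrable_const _)).sub
    (integrable_smoothInd₁ hμ y w)).sub ((integrable_smoothInd₂ hμ y w).div_const 2)

lemma integral_smoothInd_eq (hg : IsCutoff g g₁ g₂ g₃ C) (hμ : MemLp id 3 μ) (y w : ι → ℝ) :
    ∫ v, smoothInd g φ β y (w + v) ∂μ = smoothInd g φ β y w + ∫ v, smoothInd₁ g₁ φ β y w v ∂μ +
      (∫ v, smoothInd₂ g₁ g₂ φ β y w v ∂μ) / 2 + ∫ v, smoothIndRem g g₁ g₂ φ β y w v ∂μ := by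
  have i1 := integrable_smoothInd₁ (g₁ := g₁) (φ := φ) (β := β) hμ y w
  have i2 := integrable_smoothInd₂ (g₁ := g₁) (g₂ := g₂) (φ := φ) (β := β) hμ y w
  have i0 := integrable_smoothInd hg φ β y w μ
  have h : ∫ v, smoothIndRem g g₁ g₂ φ β y w v ∂μ = ∫ v, smoothInd g φ β y (w + v) ∂μ -
      smoothInd g φ β y w - ∫ v, smoothInd₁ g₁ φ β y w v ∂μ -
      (∫ v, smoothInd₂ g₁ g₂ φ β y w v ∂μ) / 2 := by
    have j1 : Integrable (fun v => smoothInd g φ β y (w + v) - smoothInd g φ β y w) μ :=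
      i0.sub (integrable_const _)
    have j2 : Integrable (fun v => smoothInd g φ β y (w + v) - smoothInd g φ β y w -
      smoothInd₁ g₁ φ β y w v) μ := j1.sub i1
    simp only [smoothIndRem]
    rw [integral_sub j2 (i2.div_const 2), integral_sub j1 i1, integral_sub i0 (integrable_const _),
      integral_div]
    simp
  rw [h]; ring

/-- For short increments the soft weights depend only on `w` and sum to one, so averaging over `v`
leaves a convex combination of coordinatewise third moments. The bound `T` thus involves the maximum
of expectations, while an expectation of a maximum enters only through the truncated tail. -/
lemma abs_integral_smoothIndRem_le (hg : IsCutoff g g₁ g₂ g₃ C) (hC : 0 < C) (hφ : 0 < φ)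
    (hφβ : φ ≤ β) (hμ : MemLp id 3 μ) {T : ℝ} (hT : ∀ k, ∫ v, |v k| ^ 3 ∂μ ≤ T) (y w : ι → ℝ) :
    |∫ v, smoothIndRem g g₁ g₂ φ β y w v ∂μ| ≤
      38 * C * (φ * β ^ 2) * ((strip φ β y 1).indicator 1 w * T + tailCube β μ) := by
  have hβ : 0 < β := hφ.trans_le hφβ
  set I : ℝ := (strip φ β y 1).indicator 1 w with hI
  have hI0 : 0 ≤ I := Set.indicator_nonneg (fun _ _ => zero_le_one) w
  set far : Set (ι → ℝ) := {v : ι → ℝ | 1 / 4 < β * ‖v‖} with hfar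
  have hint1 : Integrable (fun v => softAbsCube β y w v) μ :=
    integrable_finsetSum _ fun k _ => (integrable_abs_cube hμ k).const_mul _
  have hint2 : Integrable (far.indicator fun v => ‖v‖ ^ 3) μ :=
    (integrable_norm_cube hμ).indicator (measurableSet_far β)
  have hpt : ∀ v, |smoothIndRem g g₁ g₂ φ β y w v| ≤ 38 * C * (φ * β ^ 2) *
      (I * softAbsCube β y w v + far.indicator (fun v => ‖v‖ ^ 3) v) := by
    intro v
    have h0 := softAbsCube_nonneg β y w v
    by_cases hv : v ∈ far
    · rw [Set.indicator_of_mem hv]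
      refine (abs_smoothIndRem_le_norm hg hC hφ hφβ y w v).trans ?_
      gcongr
      nlinarith [mul_nonneg hI0 h0]
    · rw [Set.indicator_of_notMem hv, add_zero]
      exact abs_smoothIndRem_le_of_small hg hC hφ hφβ y w v (not_lt.1 hv)
  have hsoft : ∫ v, softAbsCube β y w v ∂μ ≤ T := by
    simp only [softAbsCube]
    rw [integral_finsetSum _ fun k _ => (integrable_abs_cube hμ k).const_mul _]
    calc ∑ k, ∫ v, softWeight β y w k * |v k| ^ 3 ∂μ
        = ∑ k, softWeight β y w k * ∫ v, |v k| ^ 3 ∂μ := by simp only [integral_const_mul]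
      _ ≤ ∑ k, softWeight β y w k * T := Finset.sum_le_sum fun k _ =>
          mul_le_mul_of_nonneg_left (hT k) (softWeight_pos β y w k).le
      _ = T := by rw [← Finset.sum_mul, sum_softWeight, one_mul]
  calc |∫ v, smoothIndRem g g₁ g₂ φ β y w v ∂μ|
      ≤ ∫ v, |smoothIndRem g g₁ g₂ φ β y w v| ∂μ := abs_integral_le_integral_abs
    _ ≤ ∫ v, 38 * C * (φ * β ^ 2) *
        (I * softAbsCube β y w v + far.indicator (fun v => ‖v‖ ^ 3) v) ∂μ :=
        integral_mono (integrable_smoothIndRem hg hμ y w).abs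
          (((hint1.const_mul I).add hint2).const_mul _) hpt
    _ = 38 * C * (φ * β ^ 2) * (I * ∫ v, softAbsCube β y w v ∂μ + tailCube β μ) := by
        rw [integral_const_mul, integral_add (hint1.const_mul I) hint2, integral_const_mul]
        rfl
    _ ≤ _ := by gcongr

variable {ν κ : Measure (ι → ℝ)} [IsProbabilityMeasure ν] [IsProbabilityMeasure κ]

/-- One exchange step. -/
lemma abs_integral_conv_sub_le (hg : IsCutoff g g₁ g₂ g₃ C) (hC : 0 < C) (hφ : 0 < φ)
    (hφβ : φ ≤ β) (h : MomentsMatch μ ν) {T D : ℝ} (hTμ : ∀ k, ∫ v, |v k| ^ 3 ∂μ ≤ T)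
    (hTν : ∀ k, ∫ v, |v k| ^ 3 ∂ν ≤ T) (hD : tailCube β μ + tailCube β ν ≤ D) (y : ι → ℝ) :
    |∫ z, smoothInd g φ β y z ∂(κ ∗ μ) - ∫ z, smoothInd g φ β y z ∂(κ ∗ ν)| ≤
      38 * C * (φ * β ^ 2) * (2 * T * κ.real (strip φ β y 1) + D) := by
  have hfin : ∀ ξ : Measure (ι → ℝ), IsProbabilityMeasure ξ → Integrable (smoothInd g φ β y) ξ := by
    intro ξ _
    simpa using integrable_smoothInd hg φ β y 0 ξ
  have hiμ := hfin (κ ∗ μ) inferInstance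
  have hiν := hfin (κ ∗ ν) inferInstance
  rw [integral_conv hiμ, integral_conv hiν]
  have houter : ∀ ξ : Measure (ι → ℝ), IsProbabilityMeasure ξ →
      Integrable (fun w => ∫ v, smoothInd g φ β y (w + v) ∂ξ) κ := by
    intro ξ _
    have := (hfin (κ ∗ ξ) inferInstance)
    rw [Measure.conv, integrable_map_measure (continuous_smoothInd hg φ β y).aestronglyMeasurable
      (by fun_prop)] at this
    exact this.integral_prod_left
  rw [← integral_sub (houter μ inferInstance) (houter ν inferInstance)]
  have hpt : ∀ w, |∫ v, smoothInd g φ β y (w + v) ∂μ - ∫ v, smoothInd g φ β y (w + v) ∂ν| ≤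
      38 * C * (φ * β ^ 2) * (2 * T * (strip φ β y 1).indicator 1 w + D) := by
    intro w
    rw [integral_smoothInd_eq (g₁ := g₁) (g₂ := g₂) hg h.memLp_left,
      integral_smoothInd_eq (g₁ := g₁) (g₂ := g₂) hg h.memLp_right,
      h.integral_smoothInd₁_eq, h.integral_smoothInd₂_eq, add_sub_add_left_eq_sub]
    refine (abs_sub _ _).trans ?_
    refine (add_le_add (abs_integral_smoothIndRem_le hg hC hφ hφβ h.memLp_left hTμ y w)
      (abs_integral_smoothIndRem_le hg hC hφ hφβ h.memLp_right hTν y w)).trans ?_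
    rw [← mul_add]
    refine mul_le_mul_of_nonneg_left ?_ (by positivity)
    linarith
  have hind : Integrable ((strip φ β y 1).indicator (1 : (ι → ℝ) → ℝ)) κ :=
    (integrable_const (1 : ℝ)).indicator (measurableSet_strip φ β y 1)
  calc |∫ w, (∫ v, smoothInd g φ β y (w + v) ∂μ - ∫ v, smoothInd g φ β y (w + v) ∂ν) ∂κ|
      ≤ ∫ w, |∫ v, smoothInd g φ β y (w + v) ∂μ - ∫ v, smoothInd g φ β y (w + v) ∂ν| ∂κ :=
        abs_integral_le_integral_abs
    _ ≤ ∫ w, 38 * C * (φ * β ^ 2) * (2 * T * (strip φ β y 1).indicator 1 w + D) ∂κ :=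
        integral_mono ((houter μ inferInstance).sub (houter ν inferInstance)).abs
          (((hind.const_mul _).add (integrable_const _)).const_mul _) hpt
    _ = _ := by
        rw [integral_const_mul, integral_add (hind.const_mul _) (integrable_const _),
          integral_const_mul, integral_indicator_one (measurableSet_strip φ β y 1)]
        simp

/-- A short independent increment keeps a point of the strip in a wider strip. This passes from `κ`,
which lacks one summand, to the chain element `κ ∗ ν`. -/
lemma real_strip_mul_le (hφ : 0 < φ) (hφβ : φ ≤ β) (y : ι → ℝ) :
    κ.real (strip φ β y 1) * ν.real {v | β * ‖v‖ ≤ 1 / 4} ≤ (κ ∗ ν).real (strip φ β y 2) := by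
  have hβ : 0 < β := hφ.trans_le hφβ
  have hm : Measurable fun q : (ι → ℝ) × (ι → ℝ) => q.1 + q.2 := by fun_prop
  rw [Measure.conv, map_measureReal_apply hm (measurableSet_strip φ β y 2),
    ← measureReal_prod_prod]
  refine measureReal_mono ?_
  rintro ⟨w, v⟩ ⟨hw, hv⟩
  have hv' : φ * ‖v‖ ≤ 1 / 4 := (mul_le_mul_of_nonneg_right hφβ (norm_nonneg _)).trans hv
  have h1 := mul_le_mul_of_nonneg_left (smoothMax_add_le hβ y w v) hφ.le
  have h2 := mul_le_mul_of_nonneg_left (smoothMax_sub_le hβ y w v) hφ.le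
  have := hw.1
  have := hw.2
  constructor <;> simp only <;> linarith

/-- The smooth maximum exceeds the true one by at most `log (card) / β ≤ 2/φ`, so the condition `-2
≤ φ F ≤ 3` forces the true maximum into `(-5/φ, 3/φ]`. -/
lemma real_strip_le (hφ : 0 < φ) (hβ : 0 < β) (hcard : Real.log (Fintype.card ι) / β ≤ 2 / φ)
    (y : ι → ℝ) : κ.real (strip φ β y 2) ≤
      κ.real (orthant fun k => y k + 3 / φ) - κ.real (orthant fun k => y k - 5 / φ) := by
  have hsub : (orthant fun k => y k - 5 / φ) ⊆ orthant fun k => y k + 3 / φ := by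
    intro z hz k
    have h1 : 0 ≤ 3 / φ := by positivity
    have h2 : 0 ≤ 5 / φ := by positivity
    have := hz k
    linarith
  rw [← measureReal_sdiff hsub (measurableSet_orthant _)]
  refine measureReal_mono fun w hw => ⟨fun k => ?_, fun hk => ?_⟩
  · have h1 := le_smoothMax hβ y w k
    have h2 : smoothMax β y w ≤ 3 / φ := by
      rw [le_div_iff₀ hφ, mul_comm]; have := hw.2; linarith
    linarith
  · have h1 := smoothMax_le hβ y w (c := -(5 / φ)) fun k => by have := hk k; linarith
    have h2 : φ * smoothMax β y w ≤ φ * (-(5 / φ) + 2 / φ) :=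
      mul_le_mul_of_nonneg_left (by linarith) hφ.le
    have h3 : φ * (-(5 / φ) + 2 / φ) = -3 := by field_simp; norm_num
    have := hw.1
    linarith

lemma real_orthant_le_integral (hg : IsCutoff g g₁ g₂ g₃ C) (hφ : 0 < φ) (hβ : 0 < β)
    (hcard : Real.log (Fintype.card ι) / β ≤ 2 / φ) (y : ι → ℝ) :
    κ.real (orthant fun k => y k - 2 / φ) ≤ ∫ z, smoothInd g φ β y z ∂κ := by
  rw [← integral_indicator_one (measurableSet_orthant _)]
  refine integral_mono ((integrable_const (1 : ℝ)).indicator (measurableSet_orthant _))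
    (by simpa using integrable_smoothInd hg φ β y 0 κ) fun w => ?_
  by_cases hw : w ∈ orthant fun k => y k - 2 / φ
  · rw [Set.indicator_of_mem hw]
    have h1 := smoothMax_le hβ y w (c := -(2 / φ)) fun k => by have := hw k; linarith
    have h2 : φ * smoothMax β y w ≤ 0 := mul_nonpos_of_nonneg_of_nonpos hφ.le (by linarith)
    exact (hg.eq_one _ h2).ge
  · rw [Set.indicator_of_notMem hw]
    exact hg.nonneg _

lemma integral_le_real_orthant (hg : IsCutoff g g₁ g₂ g₃ C) (hφ : 0 < φ) (hβ : 0 < β)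
    (y : ι → ℝ) : ∫ z, smoothInd g φ β y z ∂κ ≤ κ.real (orthant fun k => y k + 1 / φ) := by
  rw [← integral_indicator_one (measurableSet_orthant _)]
  refine integral_mono (by simpa using integrable_smoothInd hg φ β y 0 κ)
    ((integrable_const (1 : ℝ)).indicator (measurableSet_orthant _)) fun w => ?_
  by_cases hw : w ∈ orthant fun k => y k + 1 / φ
  · rw [Set.indicator_of_mem hw]
    exact hg.le_one _
  · rw [Set.indicator_of_notMem hw]
    refine (hg.eq_zero _ ?_).le
    obtain ⟨k, hk⟩ : ∃ k, y k + 1 / φ < w k := by simpa [orthant] using hw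
    have h1 := le_smoothMax hβ y w k
    have h2 : 1 / φ ≤ smoothMax β y w := by linarith
    rwa [div_le_iff₀' hφ] at h2

/-- A comparison of orthant probabilities along a chain of exchanges. -/
theorem abs_real_orthant_sub_le_of_exchange (hg : IsCutoff g g₁ g₂ g₃ C) (hC : 0 < C) (hφ : 0 < φ)
    (hφβ : φ ≤ β) (hcard : Real.log (Fintype.card ι) / β ≤ 2 / φ) (h : MomentsMatch μ ν)
    {T D A : ℝ} (hTμ : ∀ k, ∫ v, |v k| ^ 3 ∂μ ≤ T) (hTν : ∀ k, ∫ v, |v k| ^ 3 ∂ν ≤ T)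
    (hD : tailCube β μ + tailCube β ν ≤ D) {n : ℕ} {lam kap : ℕ → Measure (ι → ℝ)}
    (hlam : ∀ i ≤ n, IsProbabilityMeasure (lam i)) (hkap : ∀ i < n, IsProbabilityMeasure (kap i))
    (hlamμ : ∀ i < n, lam (i + 1) = kap i ∗ μ) (hlamν : ∀ i < n, lam i = kap i ∗ ν)
    (hA : ∀ (y : ι → ℝ) (ε : ℝ), 0 ≤ ε →
      (lam 0).real (orthant fun k => y k + ε) - (lam 0).real (orthant y) ≤ A * ε)
    (hsmall : 1 / 2 ≤ ν.real {v | β * ‖v‖ ≤ 1 / 4})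
    (hT : n * (38 * C * (φ * β ^ 2)) * T ≤ 1 / 16) (y : ι → ℝ) :
    |(lam n).real (orthant y) - (lam 0).real (orthant y)| ≤
      10 * A / φ + 2 * (n * (38 * C * (φ * β ^ 2)) * D) := by
  have hβ : 0 < β := hφ.trans_le hφβ
  set c := 38 * C * (φ * β ^ 2) with hc
  have hc0 : 0 < c := by positivity
  have hT0 : 0 ≤ T := (integral_nonneg fun v => by positivity).trans (hTν (Classical.arbitrary ι))
  have htail : ∀ ξ : Measure (ι → ℝ), 0 ≤ tailCube β ξ := fun ξ =>
    integral_nonneg fun v => Set.indicator_nonneg (fun _ _ => by positivity) v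
  have hD0 : 0 ≤ D := (add_nonneg (htail μ) (htail ν)).trans hD
  have hA0 : 0 ≤ A / φ := by
    have h1 := hA y (1 / φ) (by positivity)
    have h2 : (lam 0).real (orthant y) ≤ (lam 0).real (orthant fun k => y k + 1 / φ) := by
      have := hlam 0 (Nat.zero_le n)
      refine measureReal_mono fun z hz k => (hz k).trans ?_
      have : 0 ≤ 1 / φ := by positivity
      linarith
    rw [mul_one_div] at h1
    linarith
  -- The supremum runs over all intermediate measures as well as all orthants, since the strip bound
  -- at step `i` refers to the error of `lam i`.
  let d : Fin (n + 1) × (ι → ℝ) → ℝ := fun q =>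
    |(lam q.1).real (orthant q.2) - (lam 0).real (orthant q.2)|
  have hbdd : BddAbove (Set.range d) := by
    refine ⟨1, ?_⟩
    rintro _ ⟨q, rfl⟩
    have := hlam q.1 (Nat.lt_succ_iff.1 q.1.2)
    have := hlam 0 (Nat.zero_le n)
    refine abs_sub_le_of_nonneg_of_le measureReal_nonneg measureReal_le_one measureReal_nonneg
      measureReal_le_one
  set ρ := ⨆ q, d q with hρ
  have hle : ∀ i ≤ n, ∀ y, |(lam i).real (orthant y) - (lam 0).real (orthant y)| ≤ ρ :=
    fun i hi y => le_ciSup hbdd (⟨i, Nat.lt_succ_iff.2 hi⟩, y)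
  -- The outer factor `2` comes from the small ball, `2 ρ` from replacing `lam i` by `lam 0` at both
  -- ends, and `8 / φ` is the width of the layer.
  have hkapstrip : ∀ i < n, ∀ y, (kap i).real (strip φ β y 1) ≤ 2 * (2 * ρ + 8 * (A / φ)) := by
    intro i hi y
    have := hkap i hi
    have := hlam i hi.le
    have h1 := real_strip_mul_le (κ := kap i) (ν := ν) hφ hφβ y
    rw [← hlamν i hi] at h1
    have h2 := h1.trans (real_strip_le hφ hβ hcard y)
    have h3 := abs_le.1 (hle i hi.le fun k => y k + 3 / φ)
    have h4 := abs_le.1 (hle i hi.le fun k => y k - 5 / φ)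
    have h5 := hA (fun k => y k - 5 / φ) (8 / φ) (by positivity)
    have h6 : (fun k => y k - 5 / φ + 8 / φ) = fun k => y k + 3 / φ := by
      ext k; ring
    rw [h6] at h5
    have h7 : A * (8 / φ) = 8 * (A / φ) := by ring
    have h8 := mul_le_mul_of_nonneg_left hsmall
      (measureReal_nonneg (μ := kap i) (s := strip φ β y 1))
    linarith [h3.1, h3.2, h4.1, h4.2]
  set S := c * (2 * T * (2 * (2 * ρ + 8 * (A / φ))) + D) with hS
  have hstep : ∀ i < n, ∀ y,
      |∫ z, smoothInd g φ β y z ∂(lam (i + 1)) - ∫ z, smoothInd g φ β y z ∂(lam i)| ≤ S := by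
    intro i hi y
    have := hkap i hi
    rw [hlamμ i hi, hlamν i hi]
    refine (abs_integral_conv_sub_le hg hC hφ hφβ h hTμ hTν hD y).trans ?_
    have := hkapstrip i hi y
    rw [hS]
    gcongr
  have hchain : ∀ i ≤ n, ∀ y,
      |∫ z, smoothInd g φ β y z ∂(lam i) - ∫ z, smoothInd g φ β y z ∂(lam 0)| ≤ i * S := by
    intro i
    induction i with
    | zero => intro _ y; simp
    | succ i ih =>
      intro hi y
      have h1 := ih (by omega) y
      have h2 := hstep i (by omega) y
      have h3 := abs_sub_le (∫ z, smoothInd g φ β y z ∂(lam (i + 1)))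
        (∫ z, smoothInd g φ β y z ∂(lam i)) (∫ z, smoothInd g φ β y z ∂(lam 0))
      push_cast
      linarith
  have hρ0 : 0 ≤ ρ := (abs_nonneg _).trans (hle 0 (Nat.zero_le n) y)
  -- The condition `n c T ≤ 1/16` turns `8 ρ + 32 A/φ` into `ρ/2 + 2 A/φ`.
  have hnS : n * S ≤ ρ / 2 + 2 * (A / φ) + n * c * D := by
    have h1 : n * S = n * c * T * (8 * ρ + 32 * (A / φ)) + n * c * D := by rw [hS]; ring
    rw [h1]
    have := mul_le_mul_of_nonneg_right hT (by positivity : 0 ≤ 8 * ρ + 32 * (A / φ))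
    linarith
  have hS0 : 0 ≤ S := by positivity
  -- Returning from smoothed to sharp indicators shifts the threshold by `3/φ` in total, an extra `3
  -- A/φ`. The threshold of the smoothed indicator is displaced so that all of this shift falls on
  -- `lam 0`, the only measure with known anti-concentration.
  have hself : ∀ q, d q ≤ ρ / 2 + 5 * (A / φ) + n * c * D := by
    rintro ⟨i, y⟩
    have hi : (i : ℕ) ≤ n := Nat.lt_succ_iff.1 i.2
    have := hlam i hi
    have := hlam 0 (Nat.zero_le n)
    have hiS : i * S ≤ n * S := by gcongr
    have h3A : A * (3 / φ) = 3 * (A / φ) := by ring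
    change |(lam i).real (orthant y) - (lam 0).real (orthant y)| ≤ _
    rw [abs_le]
    constructor
    · have a1 := hchain i hi fun k => y k - 1 / φ
      have a2 := real_orthant_le_integral (κ := lam 0) hg hφ hβ hcard fun k => y k - 1 / φ
      have a3 := integral_le_real_orthant (κ := lam i) hg hφ hβ fun k => y k - 1 / φ
      have a4 := hA (fun k => y k - 3 / φ) (3 / φ) (by positivity)
      have e1 : (fun k => y k - 1 / φ + 1 / φ) = y := by ext k; ring
      have e2 : (fun k => y k - 1 / φ - 2 / φ) = fun k => y k - 3 / φ := by ext k; ring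
      have e3 : (fun k => y k - 3 / φ + 3 / φ) = y := by ext k; ring
      rw [e1] at a3
      rw [e2] at a2
      rw [e3] at a4
      have := abs_le.1 a1
      linarith [this.1, this.2]
    · have a1 := hchain i hi fun k => y k + 2 / φ
      have a2 := real_orthant_le_integral (κ := lam i) hg hφ hβ hcard fun k => y k + 2 / φ
      have a3 := integral_le_real_orthant (κ := lam 0) hg hφ hβ fun k => y k + 2 / φ
      have a4 := hA y (3 / φ) (by positivity)
      have e1 : (fun k => y k + 2 / φ + 1 / φ) = fun k => y k + 3 / φ := by ext k; ring
      have e2 : (fun k => y k + 2 / φ - 2 / φ) = y := by ext k; ring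
      rw [e1] at a3
      rw [e2] at a2
      have := abs_le.1 a1
      linarith [this.1, this.2]
  -- Since `ρ` is finite, `ρ/2` can be absorbed on the left.
  have hfinal : ρ ≤ ρ / 2 + 5 * (A / φ) + n * c * D := ciSup_le hself
  have := hle n le_rfl y
  have e : 10 * A / φ = 10 * (A / φ) := by ring
  rw [e]
  linarith

end Lindeberg

/-! ### Sums of i.i.d. vectors against a Gaussian vector -/

section ConvPow

/-- The law of the sum of `m` independent vectors with law `μ`. -/
def convPow {E : Type*} [AddMonoid E] [MeasurableSpace E] (μ : Measure E) : ℕ → Measure E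
  | 0 => Measure.dirac 0
  | m + 1 => convPow μ m ∗ μ

instance isProbabilityMeasure_convPow {E : Type*} [AddMonoid E] [MeasurableSpace E]
    [MeasurableAdd₂ E] (μ : Measure E) [IsProbabilityMeasure μ] (m : ℕ) :
    IsProbabilityMeasure (convPow μ m) := by
  induction m with
  | zero => rw [convPow]; infer_instance
  | succ m ih => rw [convPow]; infer_instance

lemma map_sum_pi_eq_convPow {α E : Type*} [MeasurableSpace α] [AddCommMonoid E]
    [MeasurableSpace E] [MeasurableAdd₂ E] (η : Measure α) [IsProbabilityMeasure η] {ξ : α → E}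
    (hξ : Measurable ξ) (m : ℕ) :
    (Measure.pi fun _ : Fin m => η).map (fun x => ∑ i, ξ (x i)) = convPow (η.map ξ) m := by
  have := Measure.isProbabilityMeasure_map (μ := η) hξ.aemeasurable
  induction m with
  | zero => simp [convPow]
  | succ m ih =>
    have hmp := measurePreserving_piFinSuccAbove (fun _ : Fin (m + 1) => η) 0
    have hsum : ∀ k : ℕ, Measurable fun x : Fin k → α => ∑ i, ξ (x i) := fun k =>
      Finset.measurable_sum _ fun i _ => hξ.comp (measurable_pi_apply i)
    have hfac : (fun x : Fin (m + 1) → α => ∑ i, ξ (x i)) =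
        ((fun q : E × E => q.1 + q.2) ∘ Prod.map ξ fun x : Fin m → α => ∑ i, ξ (x i)) ∘
          MeasurableEquiv.piFinSuccAbove (fun _ => α) 0 := by
      ext x
      simp [Fin.sum_univ_succ, MeasurableEquiv.piFinSuccAbove, Fin.insertNthEquiv, Fin.tail]
    rw [hfac, ← Measure.map_map (measurable_add.comp (hξ.prodMap (hsum m)))
      (MeasurableEquiv.measurable _), hmp.map_eq, ← Measure.map_map measurable_add
      (hξ.prodMap (hsum m)), ← Measure.map_prod_map _ _ hξ (hsum m), ih, convPow,
      Measure.conv_comm]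
    rfl

end ConvPow

/-! ### The Gaussian convolution semigroup -/

section GaussianScale

variable {ι : Type*}

/-- The law of `√t Z`, where `Z` has law `γ`. -/
def sqrtScale (γ : Measure (ι → ℝ)) (t : ℝ) : Measure (ι → ℝ) := γ.map fun v => √t • v

lemma sqrtScale_zero (γ : Measure (ι → ℝ)) [IsProbabilityMeasure γ] :
    sqrtScale γ 0 = Measure.dirac 0 := by
  simp [sqrtScale]

lemma sqrtScale_one (γ : Measure (ι → ℝ)) : sqrtScale γ 1 = γ := by
  simp [sqrtScale]

variable [Fintype ι]

instance isProbabilityMeasure_sqrtScale (γ : Measure (ι → ℝ)) [IsProbabilityMeasure γ] (t : ℝ) :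
    IsProbabilityMeasure (sqrtScale γ t) :=
  Measure.isProbabilityMeasure_map (by fun_prop)

variable {γ : Measure (ι → ℝ)} [IsGaussian γ]

lemma integral_dual_eq_zero (h0 : ∀ k, ∫ v, v k ∂γ = 0) (L : StrongDual ℝ (ι → ℝ)) :
    ∫ v, L v ∂γ = 0 := by
  classical
  have h : ∀ v, L v = ∑ k, v k * L (Pi.single k 1) := fun v => by
    have := LinearMap.pi_apply_eq_sum_univ (L : (ι → ℝ) →ₗ[ℝ] ℝ) v
    simp only [ContinuousLinearMap.coe_coe, smul_eq_mul] at this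
    rw [this]
    refine Finset.sum_congr rfl fun k _ => ?_
    congr 2
    ext j
    simp [Pi.single_apply, eq_comm]
  have hint : ∀ k, Integrable (fun v : ι → ℝ => v k) γ := fun k =>
    ((IsGaussian.memLp_id γ 2 (by simp)).eval k).integrable (by norm_num)
  refine (integral_congr_ae (Filter.Eventually.of_forall h)).trans ?_
  rw [integral_finsetSum _ fun k _ => (hint k).mul_const _]
  simp [integral_mul_const, h0]

lemma charFunDual_sqrtScale (h0 : ∀ k, ∫ v, v k ∂γ = 0) {t : ℝ} (ht : 0 ≤ t)
    (L : StrongDual ℝ (ι → ℝ)) :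
    charFunDual (sqrtScale γ t) L = Complex.exp (-(t * Var[L; γ] : ℝ) / 2) := by
  have h1 : (fun v : ι → ℝ => √t • v) = ⇑(√t • ContinuousLinearMap.id ℝ (ι → ℝ)) := by
    ext v; simp
  have h2 : L ∘SL (√t • ContinuousLinearMap.id ℝ (ι → ℝ)) = √t • L := by
    ext v; simp
  rw [sqrtScale, h1, charFunDual_map, h2, IsGaussian.charFunDual_eq, integral_complex_ofReal,
    integral_dual_eq_zero h0]
  have h3 : Var[⇑(√t • L); γ] = t * Var[L; γ] := by
    have : ⇑(√t • L) = √t • ⇑L := rfl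
    rw [this, variance_smul, Real.sq_sqrt ht]
  rw [h3]
  congr 1
  push_cast
  ring

/-- Variances add, as the characteristic functions show. This splits one Gaussian increment off the
unreplaced Gaussian block in the exchange chain. -/
lemma sqrtScale_conv_sqrtScale (h0 : ∀ k, ∫ v, v k ∂γ = 0) {s t : ℝ} (hs : 0 ≤ s) (ht : 0 ≤ t) :
    sqrtScale γ s ∗ sqrtScale γ t = sqrtScale γ (s + t) := by
  refine Measure.ext_of_charFunDual (funext fun L => ?_)
  rw [charFunDual_conv, charFunDual_sqrtScale h0 hs, charFunDual_sqrtScale h0 ht,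
    charFunDual_sqrtScale h0 (add_nonneg hs ht), ← Complex.exp_add]
  congr 1
  push_cast
  ring

end GaussianScale

/-! ### The Lindeberg chain from a Gaussian law to an i.i.d. sum -/

section Comparison

variable {ι : Type*} [Fintype ι] [Nonempty ι] {g g₁ g₂ g₃ : ℝ → ℝ} {C φ β : ℝ}
  {γ μ : Measure (ι → ℝ)} [IsGaussian γ] [IsProbabilityMeasure μ]

/-- Orthant probabilities of a sum of i.i.d. vectors and of a Gaussian vector. -/
theorem abs_real_orthant_convPow_sub_le (hg : IsCutoff g g₁ g₂ g₃ C) (hC : 0 < C) (hφ : 0 < φ)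
    {ℓ : ℝ} (hℓ : 1 ≤ ℓ) (hcard : Fintype.card ι ≤ Real.exp (2 * ℓ)) {n : ℕ} (hn : 0 < n)
    (hγ0 : ∀ k, ∫ v, v k ∂γ = 0) {σ : ι → ℝ} {s : ℝ} (hs : 0 < s) (hσ : ∀ k, s ≤ σ k)
    (hγ : ∀ k, γ.map (fun z => z k) = gaussianReal 0 (σ k ^ 2).toNNReal)
    (h : MomentsMatch μ (sqrtScale γ (1 / n))) {T D : ℝ}
    (hTμ : ∀ k, ∫ v, |v k| ^ 3 ∂μ ≤ T) (hTν : ∀ k, ∫ v, |v k| ^ 3 ∂(sqrtScale γ (1 / n)) ≤ T)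
    (hD : tailCube (φ * ℓ) μ + tailCube (φ * ℓ) (sqrtScale γ (1 / n)) ≤ D)
    (hsmall : 1 / 2 ≤ (sqrtScale γ (1 / n)).real {v | φ * ℓ * ‖v‖ ≤ 1 / 4})
    (hT : n * (38 * C * (φ * (φ * ℓ) ^ 2)) * T ≤ 1 / 16) (y : ι → ℝ) :
    |(convPow μ n).real (orthant y) - γ.real (orthant y)| ≤
      330 / s * (√ℓ / φ) + 2 * (n * (38 * C * (φ * (φ * ℓ) ^ 2)) * D) := by
  have hn' : (0 : ℝ) < n := by exact_mod_cast hn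
  have hφβ : φ ≤ φ * ℓ := le_mul_of_one_le_right hφ.le hℓ
  have hc0 : (0 : ℝ) < Fintype.card ι := by exact_mod_cast Fintype.card_pos
  have hlog : Real.log (Fintype.card ι) / (φ * ℓ) ≤ 2 / φ := by
    have h1 : Real.log (Fintype.card ι) ≤ 2 * ℓ := (Real.log_le_iff_le_exp hc0).2 hcard
    rw [div_le_div_iff₀ (by positivity) hφ]
    nlinarith
  -- `lam i` has `i` draws and `n - i` Gaussian increments; `kap i` is what `lam i` and `lam (i +
  -- 1)` share.
  set lam : ℕ → Measure (ι → ℝ) := fun i => convPow μ i ∗ sqrtScale γ ((n - i : ℝ) / n) with hlam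
  set kap : ℕ → Measure (ι → ℝ) := fun i => convPow μ i ∗ sqrtScale γ ((n - i - 1 : ℝ) / n)
    with hkap
  have hlam0 : lam 0 = γ := by
    simp [hlam, convPow, hn'.ne', sqrtScale_one]
  have hlamn : lam n = convPow μ n := by
    simp [hlam, sqrtScale_zero]
  have key := abs_real_orthant_sub_le_of_exchange (n := n) (lam := lam) (kap := kap)
    (A := 33 / s * √ℓ) hg hC hφ hφβ hlog h hTμ hTν hD
    (fun i _ => by simp only [hlam]; infer_instance)
    (fun i _ => by simp only [hkap]; infer_instance)
    (fun i _ => by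
      simp only [hlam, hkap, convPow]
      rw [Measure.conv_assoc, Measure.conv_assoc, Measure.conv_comm μ]
      push_cast
      ring_nf)
    (fun i hi => by
      have hi' : (0 : ℝ) ≤ n - i - 1 := by
        have : ((i + 1 : ℕ) : ℝ) ≤ n := by exact_mod_cast hi
        push_cast at this
        linarith
      simp only [hlam, hkap]
      rw [Measure.conv_assoc, sqrtScale_conv_sqrtScale hγ0 (by positivity) (by positivity)]
      congr 2
      ring)
    (fun y ε hε => by
      rw [hlam0]
      exact real_orthant_sub_le hs hσ hγ y hε hℓ hcard)
    hsmall hT y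
  rw [hlam0, hlamn] at key
  refine key.trans_eq ?_
  ring

end Comparison

/-! ### The two bootstrap laws for fixed data -/

section Signed

variable {p : ℕ}

/-- The sign attached to a Boolean. -/
def boolSign (s : Bool) : ℝ := if s then 1 else -1

@[simp] lemma abs_boolSign (s : Bool) : |boolSign s| = 1 := by cases s <;> simp [boolSign]

@[simp] lemma boolSign_mul_self (s : Bool) : boolSign s * boolSign s = 1 := by
  cases s <;> simp [boolSign]

/-- The coordinates of a vector together with their negatives. -/
def signed (p : ℕ) : (Fin p → ℝ) →L[ℝ] (Fin p × Bool → ℝ) :=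
  ContinuousLinearMap.pi fun k => boolSign k.2 • ContinuousLinearMap.proj k.1

@[simp] lemma signed_apply (w : Fin p → ℝ) (k : Fin p × Bool) :
    signed p w k = boolSign k.2 * w k.1 := by simp [signed]

lemma maxAbs_eq_norm (w : Fin p → ℝ) : maxAbs w = ‖w‖ := by
  refine le_antisymm (Real.iSup_le (fun j => norm_le_pi_norm w j) (norm_nonneg _)) ?_
  refine (pi_norm_le_iff_of_nonneg (Real.iSup_nonneg fun j => abs_nonneg _)).2 fun j => ?_
  exact le_ciSup (f := fun j => |w j|) (Set.finite_range _).bddAbove j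

lemma norm_signed (w : Fin p → ℝ) : ‖signed p w‖ = ‖w‖ := by
  refine le_antisymm ?_ ?_
  · refine (pi_norm_le_iff_of_nonneg (norm_nonneg _)).2 fun k => ?_
    rw [signed_apply, Real.norm_eq_abs, abs_mul, abs_boolSign, one_mul]
    exact norm_le_pi_norm w k.1
  · refine (pi_norm_le_iff_of_nonneg (norm_nonneg _)).2 fun j => ?_
    simpa using norm_le_pi_norm (signed p w) (j, true)

/-- Under the scaling `n^{-1/2}`, the cutoff `1/(4β)` with `β = φ log p` becomes the truncation
level in the definition of `M̂_n`. -/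
lemma indicator_far_smul_signed {n : ℕ} (hn : 0 < n) {φ : ℝ} (hφ : 0 < φ)
    (hp : 0 < Real.log p) (w : Fin p → ℝ) :
    {v : Fin p × Bool → ℝ | 1 / 4 < φ * Real.log p * ‖v‖}.indicator (fun v => ‖v‖ ^ 3)
      ((√n)⁻¹ • signed p w) = (√n)⁻¹ ^ 3 * truncCube n φ w := by
  have hn' : (0 : ℝ) < √n := Real.sqrt_pos.2 (by exact_mod_cast hn)
  have hnorm : ‖(√n)⁻¹ • signed p w‖ = (√n)⁻¹ * ‖w‖ := by
    rw [norm_smul, norm_signed, Real.norm_of_nonneg (by positivity)]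
  have hiff : 1 / 4 < φ * Real.log p * ‖(√n)⁻¹ • signed p w‖ ↔
      √n / (4 * φ * Real.log p) < ‖w‖ := by
    have hpos : 0 < 4 * φ * Real.log p := mul_pos (by linarith) hp
    rw [hnorm, div_lt_iff₀ hpos, div_lt_iff₀ (by norm_num)]
    have : φ * Real.log p * ((√n)⁻¹ * ‖w‖) * 4 = ‖w‖ * (4 * φ * Real.log p) / √n := by
      field_simp
    rw [this, lt_div_iff₀ hn', one_mul]
  rw [truncCube, maxAbs_eq_norm]
  by_cases h : √n / (4 * φ * Real.log p) < ‖w‖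
  · rw [if_pos h, Set.indicator_of_mem (by exact hiff.2 h), hnorm, mul_pow]
  · rw [if_neg h, mul_zero]
    have hm : (√n)⁻¹ • signed p w ∉ {v : Fin p × Bool → ℝ | 1 / 4 < φ * Real.log p * ‖v‖} :=
      fun hh => h (hiff.1 hh)
    rw [Set.indicator_of_notMem hm]

end Signed

/-! ### Moments of the bootstrap laws for fixed data -/

section Laws

variable {n p : ℕ}

/-- The law of the multiplier bootstrap sum for fixed data. -/
def mbLaw (x : Fin n → Fin p → ℝ) : Measure (Fin p → ℝ) :=
  (Measure.pi fun _ : Fin n => gaussianReal 0 1).map fun e => multiplierSum e x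

/-- The law of the empirical bootstrap sum for fixed data. -/
def ebLaw (x : Fin n → Fin p → ℝ) : Measure (Fin p → ℝ) :=
  (Measure.pi fun _ : Fin n => empiricalMeasure x).map fun xs => empiricalSum xs x

/-- The empirical covariance of two coordinates. -/
def empCov (x : Fin n → Fin p → ℝ) (j k : Fin p) : ℝ :=
  avg fun i => (x i j - sampleMean x j) * (x i k - sampleMean x k)

lemma empCov_self (x : Fin n → Fin p → ℝ) (j : Fin p) : empCov x j j = empVar x j := by
  simp [empCov, empVar, sq]

lemma avg_sub_sampleMean (hn : 0 < n) (x : Fin n → Fin p → ℝ) (j : Fin p) :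
    avg (fun i => x i j - sampleMean x j) = 0 := by
  have : (n : ℝ) ≠ 0 := by exact_mod_cast hn.ne'
  simp only [avg, Finset.sum_sub_distrib, sampleMean, Finset.sum_const, Finset.card_univ,
    Fintype.card_fin, nsmul_eq_mul]
  field_simp
  ring

lemma avg_nonneg {a : Fin n → ℝ} (h : ∀ i, 0 ≤ a i) : 0 ≤ avg a :=
  div_nonneg (Finset.sum_nonneg fun i _ => h i) (Nat.cast_nonneg n)

lemma avg_const_mul (c : ℝ) (a : Fin n → ℝ) : avg (fun i => c * a i) = c * avg a := by
  simp [avg, ← Finset.mul_sum, mul_div_assoc]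

/-- The multiplier bootstrap sum as a linear map of the multipliers. -/
def multiplierMap (x : Fin n → Fin p → ℝ) : (Fin n → ℝ) →L[ℝ] (Fin p → ℝ) :=
  ContinuousLinearMap.pi fun j =>
    ∑ i, ((x i j - sampleMean x j) / √n) • ContinuousLinearMap.proj i

lemma multiplierMap_apply (x : Fin n → Fin p → ℝ) (e : Fin n → ℝ) (j : Fin p) :
    multiplierMap x e j = ∑ i, (x i j - sampleMean x j) / √n * e i := by
  simp [multiplierMap]

lemma multiplierSum_eq (x : Fin n → Fin p → ℝ) (e : Fin n → ℝ) :
    multiplierSum e x = multiplierMap x e := by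
  ext j
  rw [multiplierMap_apply, multiplierSum, normalizedSum, Finset.sum_div]
  exact Finset.sum_congr rfl fun i _ => by ring

lemma mbLaw_eq (x : Fin n → Fin p → ℝ) :
    mbLaw x = (Measure.pi fun _ : Fin n => gaussianReal 0 1).map (multiplierMap x) := by
  simp only [mbLaw, multiplierSum_eq]

lemma iIndepFun_eval_pi_gaussianReal :
    iIndepFun (fun (i : Fin n) (e : Fin n → ℝ) => e i)
      (Measure.pi fun _ : Fin n => gaussianReal 0 1) :=
  iIndepFun_pi (X := fun _ => id) fun _ => aemeasurable_id

lemma map_eval_pi_gaussianReal (i : Fin n) :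
    (Measure.pi fun _ : Fin n => gaussianReal 0 1).map (fun e => e i) = gaussianReal 0 1 :=
  (measurePreserving_eval (fun _ : Fin n => gaussianReal 0 1) i).map_eq

lemma hasGaussianLaw_eval_pi (i : Fin n) :
    HasGaussianLaw (fun e : Fin n → ℝ => e i) (Measure.pi fun _ : Fin n => gaussianReal 0 1) := by
  refine ⟨?_⟩
  rw [map_eval_pi_gaussianReal]
  infer_instance

instance isGaussian_pi_gaussianReal :
    IsGaussian (Measure.pi fun _ : Fin n => gaussianReal 0 1) := by
  have h := iIndepFun.hasGaussianLaw (hasGaussianLaw_eval_pi (n := n))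
    iIndepFun_eval_pi_gaussianReal
  have := h.isGaussian_map
  have h2 : (fun (e : Fin n → ℝ) (i : Fin n) => e i) = id := rfl
  rwa [h2, Measure.map_id] at this

instance isGaussian_mbLaw (x : Fin n → Fin p → ℝ) : IsGaussian (mbLaw x) := by
  rw [mbLaw_eq]; infer_instance

lemma covariance_eval_pi (i l : Fin n) :
    cov[fun e : Fin n → ℝ => e i, fun e => e l; Measure.pi fun _ : Fin n => gaussianReal 0 1] =
      if i = l then 1 else 0 := by
  split_ifs with h
  · subst h
    rw [covariance_self (measurable_pi_apply i).aemeasurable]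
    have h := variance_id_gaussianReal (μ := 0) (v := 1)
    rw [← map_eval_pi_gaussianReal i, variance_map aemeasurable_id
      (measurable_pi_apply i).aemeasurable] at h
    simpa using h
  · exact (iIndepFun_eval_pi_gaussianReal.indepFun h).covariance_eq_zero
      (hasGaussianLaw_eval_pi i).memLp_two (hasGaussianLaw_eval_pi l).memLp_two

lemma integral_eval_pi (i : Fin n) :
    ∫ e : Fin n → ℝ, e i ∂(Measure.pi fun _ : Fin n => gaussianReal 0 1) = 0 := by
  have h := integral_id_gaussianReal (μ := 0) (v := 1)
  rwa [← map_eval_pi_gaussianReal i, integral_map (measurable_pi_apply i).aemeasurable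
    (by fun_prop)] at h

lemma integral_eval_mbLaw (x : Fin n → Fin p → ℝ) (j : Fin p) : ∫ s, s j ∂(mbLaw x) = 0 := by
  have hm : Measurable fun s : Fin p → ℝ => s j := measurable_pi_apply j
  rw [mbLaw_eq, integral_map (by fun_prop) hm.aestronglyMeasurable]
  simp only [multiplierMap_apply]
  rw [integral_finsetSum _ fun i _ => ((hasGaussianLaw_eval_pi i).integrable).const_mul _]
  simp [integral_const_mul, integral_eval_pi]

lemma memLp_eval_mbLaw (x : Fin n → Fin p → ℝ) (j : Fin p) :
    MemLp (fun s : Fin p → ℝ => s j) 2 (mbLaw x) :=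
  (IsGaussian.memLp_id (mbLaw x) 2 (by simp)).eval j

lemma covariance_eval_mbLaw (x : Fin n → Fin p → ℝ) (j k : Fin p) :
    cov[fun s => s j, fun s => s k; mbLaw x] = empCov x j k := by
  rw [mbLaw_eq, covariance_map_fun (measurable_pi_apply j).aestronglyMeasurable
    (measurable_pi_apply k).aestronglyMeasurable (by fun_prop)]
  simp only [multiplierMap_apply]
  rw [covariance_fun_sum_fun_sum
    (fun i => ((hasGaussianLaw_eval_pi i).memLp_two).const_mul _)
    (fun i => ((hasGaussianLaw_eval_pi i).memLp_two).const_mul _)]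
  simp only [covariance_const_mul_left, covariance_const_mul_right, covariance_eval_pi, mul_ite,
    mul_one, mul_zero, Finset.sum_ite_eq, Finset.mem_univ, if_true]
  rw [empCov, avg, Finset.sum_div]
  refine Finset.sum_congr rfl fun i _ => ?_
  rw [div_mul_div_comm, Real.mul_self_sqrt (Nat.cast_nonneg n), mul_comm]

lemma integral_mul_eval_mbLaw (x : Fin n → Fin p → ℝ) (j k : Fin p) :
    ∫ s, s j * s k ∂(mbLaw x) = empCov x j k := by
  have h := covariance_eq_sub (memLp_eval_mbLaw x j) (memLp_eval_mbLaw x k)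
  rw [covariance_eval_mbLaw, integral_eval_mbLaw] at h
  simpa using h.symm

lemma map_eval_mbLaw (x : Fin n → Fin p → ℝ) (j : Fin p) :
    (mbLaw x).map (fun s => s j) = gaussianReal 0 (empVar x j).toNNReal := by
  have hG : HasGaussianLaw (fun s : Fin p → ℝ => s j) (mbLaw x) :=
    (IsGaussian.hasGaussianLaw_id (μ := mbLaw x)).map_fun (ContinuousLinearMap.proj j)
  rw [hG.map_eq_gaussianReal, integral_eval_mbLaw,
    ← covariance_self (measurable_pi_apply j).aemeasurable, covariance_eval_mbLaw, empCov_self]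

/-- The third absolute moment of the standard normal law. -/
def gaussianAbsCube : ℝ := ∫ z, |z| ^ 3 ∂(gaussianReal 0 1)

lemma gaussianAbsCube_nonneg : 0 ≤ gaussianAbsCube := integral_nonneg fun z => by positivity

lemma empVar_nonneg (x : Fin n → Fin p → ℝ) (j : Fin p) : 0 ≤ empVar x j :=
  avg_nonneg fun _ => sq_nonneg _

lemma integral_abs_cube_mbLaw (x : Fin n → Fin p → ℝ) (j : Fin p) :
    ∫ s, |s j| ^ 3 ∂(mbLaw x) = √(empVar x j) ^ 3 * gaussianAbsCube := by
  have h1 : ∫ s, |s j| ^ 3 ∂(mbLaw x) = ∫ z, |z| ^ 3 ∂(gaussianReal 0 (empVar x j).toNNReal) := by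
    rw [← map_eval_mbLaw, integral_map (measurable_pi_apply j).aemeasurable (by fun_prop)]
  have h2 : gaussianReal 0 (empVar x j).toNNReal =
      (gaussianReal 0 1).map (fun z => √(empVar x j) * z) := by
    rw [gaussianReal_map_const_mul]
    congr 1
    · simp
    · ext
      simp [Real.sq_sqrt (empVar_nonneg x j), empVar_nonneg x j]
  rw [h1, h2, integral_map (by fun_prop) (by fun_prop), gaussianAbsCube, ← integral_const_mul]
  refine integral_congr_ae (Filter.Eventually.of_forall fun z => ?_)
  simp only [abs_mul, mul_pow, abs_of_nonneg (Real.sqrt_nonneg _)]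

/-- The power mean inequality with exponent `3/2`, applied to the squared deviations. It lets `L`
also control the Gaussian third moments. -/
lemma sqrt_empVar_pow_le (hn : 0 < n) (x : Fin n → Fin p → ℝ) (j : Fin p) :
    √(empVar x j) ^ 3 ≤ LHat x := by
  have hn' : (0 : ℝ) < n := by exact_mod_cast hn
  refine le_trans ?_ (le_ciSup (f := fun j => avg fun i => |x i j - sampleMean x j| ^ 3)
    (Set.finite_range _).bddAbove j)
  have h := Real.rpow_arith_mean_le_arith_mean_rpow Finset.univ (fun _ : Fin n => (n : ℝ)⁻¹)
    (fun i => (x i j - sampleMean x j) ^ 2) (fun _ _ => by positivity)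
    (by simp [hn'.ne']) (fun _ _ => sq_nonneg _) (p := 3 / 2) (by norm_num)
  have e1 : ∑ i, (n : ℝ)⁻¹ * (x i j - sampleMean x j) ^ 2 = empVar x j := by
    rw [← Finset.mul_sum, empVar, avg]; ring
  have e2 : ∀ i, ((x i j - sampleMean x j) ^ 2) ^ (3 / 2 : ℝ) = |x i j - sampleMean x j| ^ 3 := by
    intro i
    rw [← sq_abs, ← Real.rpow_natCast, ← Real.rpow_mul (abs_nonneg _), ← Real.rpow_natCast]
    norm_num
  have e3 : empVar x j ^ (3 / 2 : ℝ) = √(empVar x j) ^ 3 := by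
    rw [Real.sqrt_eq_rpow, ← Real.rpow_natCast, ← Real.rpow_mul (empVar_nonneg x j)]
    norm_num
  simp only [e1, e2, e3] at h
  refine h.trans_eq ?_
  rw [← Finset.mul_sum, avg]; ring

lemma isProbabilityMeasure_empiricalMeasure (hn : 0 < n) (x : Fin n → Fin p → ℝ) :
    IsProbabilityMeasure (empiricalMeasure x) := by
  refine ⟨?_⟩
  have h0 : (n : ENNReal) ≠ 0 := by exact_mod_cast hn.ne'
  simp [empiricalMeasure, ENNReal.inv_mul_cancel h0 (ENNReal.natCast_ne_top n)]

lemma integral_empiricalMeasure (x : Fin n → Fin p → ℝ) (f : (Fin p → ℝ) → ℝ) :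
    ∫ v, f v ∂(empiricalMeasure x) = avg fun i => f (x i) := by
  rw [empiricalMeasure, integral_smul_measure, integral_finsetSum_measure fun i _ =>
    integrable_dirac (by simp)]
  simp [avg, div_eq_inv_mul]

lemma ae_empiricalMeasure (x : Fin n → Fin p → ℝ) {q : (Fin p → ℝ) → Prop} (h : ∀ i, q (x i)) :
    ∀ᵐ v ∂(empiricalMeasure x), q v := by
  rw [empiricalMeasure]
  refine Measure.ae_smul_measure ?_ _
  rw [← Measure.sum_fintype, Measure.ae_sum_iff]
  exact fun i => (ae_dirac_eq (x i)).symm ▸ h i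

end Laws

/-! ### The draws and Gaussian increments entering the exchange -/

section Exchange

variable {n p : ℕ}

/-- A centered and scaled observation, with its negative. -/
def scaledObs (x : Fin n → Fin p → ℝ) (v : Fin p → ℝ) : Fin p × Bool → ℝ :=
  (√n)⁻¹ • signed p fun j => v j - sampleMean x j

lemma measurable_scaledObs (x : Fin n → Fin p → ℝ) : Measurable (scaledObs x) := by
  unfold scaledObs
  have h : Measurable fun v : Fin p → ℝ => signed p fun j => v j - sampleMean x j :=
    (signed p).continuous.measurable.comp (by fun_prop)
  exact h.const_smul ((√n)⁻¹ : ℝ)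

/-- The law of a centered and scaled draw. -/
def drawLaw (x : Fin n → Fin p → ℝ) : Measure (Fin p × Bool → ℝ) :=
  (empiricalMeasure x).map (scaledObs x)

lemma isProbabilityMeasure_drawLaw (hn : 0 < n) (x : Fin n → Fin p → ℝ) :
    IsProbabilityMeasure (drawLaw x) := by
  have := isProbabilityMeasure_empiricalMeasure hn x
  exact Measure.isProbabilityMeasure_map (measurable_scaledObs x).aemeasurable

/-- The law of the multiplier bootstrap sum, with its negative. -/
def gaussLaw (x : Fin n → Fin p → ℝ) : Measure (Fin p × Bool → ℝ) := (mbLaw x).map (signed p)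

instance isGaussian_gaussLaw (x : Fin n → Fin p → ℝ) : IsGaussian (gaussLaw x) := by
  rw [gaussLaw]; infer_instance

lemma map_signed_ebLaw (hn : 0 < n) (x : Fin n → Fin p → ℝ) :
    (ebLaw x).map (signed p) = convPow (drawLaw x) n := by
  have := isProbabilityMeasure_empiricalMeasure hn x
  have hm : Measurable fun xs : Fin n → Fin p → ℝ => empiricalSum xs x := by
    unfold empiricalSum normalizedSum; fun_prop
  rw [drawLaw, ← map_sum_pi_eq_convPow _ (measurable_scaledObs x), ebLaw,
    Measure.map_map (signed p).continuous.measurable hm]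
  congr 1
  ext xs k
  simp only [Function.comp_apply, signed_apply, empiricalSum, normalizedSum, scaledObs,
    Finset.sum_apply, Pi.smul_apply, smul_eq_mul]
  rw [Finset.sum_div, Finset.mul_sum]
  exact Finset.sum_congr rfl fun i _ => by ring

lemma integral_drawLaw (x : Fin n → Fin p → ℝ) {f : (Fin p × Bool → ℝ) → ℝ} (hf : Measurable f) :
    ∫ v, f v ∂(drawLaw x) = avg fun i => f (scaledObs x (x i)) := by
  rw [drawLaw, integral_map (measurable_scaledObs x).aemeasurable hf.aestronglyMeasurable,
    integral_empiricalMeasure]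

lemma integral_gaussLaw (x : Fin n → Fin p → ℝ) {f : (Fin p × Bool → ℝ) → ℝ} (hf : Measurable f) :
    ∫ v, f v ∂(gaussLaw x) = ∫ s, f (signed p s) ∂(mbLaw x) := by
  rw [gaussLaw, integral_map (by fun_prop) hf.aestronglyMeasurable]

lemma integral_sqrtScale_gaussLaw (x : Fin n → Fin p → ℝ) {f : (Fin p × Bool → ℝ) → ℝ}
    (hf : Measurable f) : ∫ v, f v ∂(sqrtScale (gaussLaw x) (1 / n)) =
      ∫ s, f ((√n)⁻¹ • signed p s) ∂(mbLaw x) := by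
  rw [sqrtScale, integral_map (by fun_prop) hf.aestronglyMeasurable,
    integral_gaussLaw x (f := fun v => f (√(1 / n) • v)) (hf.comp (by fun_prop))]
  simp

lemma integral_eval_gaussLaw (x : Fin n → Fin p → ℝ) (k : Fin p × Bool) :
    ∫ v, v k ∂(gaussLaw x) = 0 := by
  rw [integral_gaussLaw x (measurable_pi_apply k)]
  simp [integral_const_mul, integral_eval_mbLaw]

lemma map_eval_gaussLaw (x : Fin n → Fin p → ℝ) (k : Fin p × Bool) :
    (gaussLaw x).map (fun v => v k) = gaussianReal 0 (√(empVar x k.1) ^ 2).toNNReal := by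
  have hG : HasGaussianLaw (fun s : Fin p × Bool → ℝ => s k) (gaussLaw x) :=
    (IsGaussian.hasGaussianLaw_id (μ := gaussLaw x)).map_fun (ContinuousLinearMap.proj k)
  have hm : Measurable fun s : Fin p × Bool → ℝ => s k := measurable_pi_apply k
  rw [hG.map_eq_gaussianReal, integral_eval_gaussLaw, Real.sq_sqrt (empVar_nonneg x k.1), gaussLaw,
    variance_map hm.aemeasurable (by fun_prop)]
  have h1 : (fun s : Fin p × Bool → ℝ => s k) ∘ signed p = fun s => boolSign k.2 * s k.1 := by
    ext s; simp
  rw [h1, variance_const_mul, ← covariance_self (measurable_pi_apply k.1).aemeasurable,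
    covariance_eval_mbLaw, empCov_self, sq, boolSign_mul_self, one_mul]

/-- Both means vanish by centring, and both second moments are the empirical covariance divided by
`n`, up to the signs. This exact matching makes the comparison of the bootstraps free of a
covariance error term. -/
lemma momentsMatch_drawLaw (hn : 0 < n) (x : Fin n → Fin p → ℝ) :
    MomentsMatch (drawLaw x) (sqrtScale (gaussLaw x) (1 / n)) where
  memLp_left := by
    have := isProbabilityMeasure_empiricalMeasure hn x
    rw [drawLaw, memLp_map_measure_iff aestronglyMeasurable_id
      (measurable_scaledObs x).aemeasurable]
    refine MemLp.of_bound (measurable_scaledObs x).aestronglyMeasurable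
      (∑ i, ‖scaledObs x (x i)‖) (ae_empiricalMeasure x fun i => ?_)
    exact Finset.single_le_sum (f := fun i => ‖scaledObs x (x i)‖) (fun _ _ => norm_nonneg _)
      (Finset.mem_univ i)
  memLp_right := by
    rw [sqrtScale, memLp_map_measure_iff aestronglyMeasurable_id (by fun_prop)]
    exact MemLp.const_smul (IsGaussian.memLp_id (gaussLaw x) 3 (by simp)) (√(1 / n) : ℝ)
  mean k := by
    rw [integral_drawLaw x (measurable_pi_apply k),
      integral_sqrtScale_gaussLaw x (measurable_pi_apply k)]
    simp only [scaledObs, Pi.smul_apply, signed_apply, smul_eq_mul, avg_const_mul,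
      avg_sub_sampleMean hn, integral_const_mul, integral_eval_mbLaw]
  second j k := by
    rw [integral_drawLaw x (f := fun v => v j * v k) (by fun_prop),
      integral_sqrtScale_gaussLaw x (f := fun v => v j * v k) (by fun_prop)]
    simp only [scaledObs, Pi.smul_apply, signed_apply, smul_eq_mul]
    have h1 : ∀ a b : ℝ, (√n)⁻¹ * (boolSign j.2 * a) * ((√n)⁻¹ * (boolSign k.2 * b)) =
        (√n)⁻¹ * (√n)⁻¹ * boolSign j.2 * boolSign k.2 * (a * b) := fun a b => by ring
    simp only [h1, avg_const_mul, integral_const_mul, integral_mul_eval_mbLaw, empCov]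

lemma abs_scaled_cube (a : ℝ) (s : Bool) :
    |(√n)⁻¹ * (boolSign s * a)| ^ 3 = (√n)⁻¹ ^ 3 * |a| ^ 3 := by
  rw [abs_mul, abs_mul, abs_boolSign, one_mul, abs_of_nonneg (by positivity), mul_pow]

lemma integral_abs_cube_drawLaw_le (x : Fin n → Fin p → ℝ) (k : Fin p × Bool) :
    ∫ v, |v k| ^ 3 ∂(drawLaw x) ≤ (√n)⁻¹ ^ 3 * LHat x := by
  rw [integral_drawLaw x (f := fun v => |v k| ^ 3) (by fun_prop)]
  simp only [scaledObs, Pi.smul_apply, signed_apply, smul_eq_mul, abs_scaled_cube, avg_const_mul]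
  gcongr
  exact le_ciSup (f := fun j => avg fun i => |x i j - sampleMean x j| ^ 3)
    (Set.finite_range _).bddAbove k.1

lemma integral_abs_cube_sqrtScale_le (hn : 0 < n) (x : Fin n → Fin p → ℝ) (k : Fin p × Bool) :
    ∫ v, |v k| ^ 3 ∂(sqrtScale (gaussLaw x) (1 / n)) ≤
      (√n)⁻¹ ^ 3 * (LHat x * gaussianAbsCube) := by
  rw [integral_sqrtScale_gaussLaw x (f := fun v => |v k| ^ 3) (by fun_prop)]
  simp only [Pi.smul_apply, signed_apply, smul_eq_mul, abs_scaled_cube, integral_const_mul]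
  rw [integral_abs_cube_mbLaw]
  have := gaussianAbsCube_nonneg
  gcongr
  exact sqrt_empVar_pow_le hn x k.1

lemma measurable_indicator_far {ι : Type*} [Fintype ι] (β : ℝ) :
    Measurable ({v : ι → ℝ | 1 / 4 < β * ‖v‖}.indicator fun v => ‖v‖ ^ 3) :=
  Measurable.indicator (by fun_prop) (measurableSet_far β)

lemma tailCube_drawLaw (hn : 0 < n) (x : Fin n → Fin p → ℝ) {φ : ℝ} (hφ : 0 < φ)
    (hp : 0 < Real.log p) :
    tailCube (φ * Real.log p) (drawLaw x) = (√n)⁻¹ ^ 3 * MHatX φ x := by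
  rw [tailCube, integral_drawLaw x (measurable_indicator_far _)]
  simp only [scaledObs, indicator_far_smul_signed hn hφ hp, avg_const_mul]
  rfl

lemma tailCube_sqrtScale (hn : 0 < n) (x : Fin n → Fin p → ℝ) {φ : ℝ} (hφ : 0 < φ)
    (hp : 0 < Real.log p) : tailCube (φ * Real.log p) (sqrtScale (gaussLaw x) (1 / n)) =
      (√n)⁻¹ ^ 3 * ∫ s, truncCube n φ s ∂(mbLaw x) := by
  rw [tailCube, integral_sqrtScale_gaussLaw x (measurable_indicator_far _)]
  simp only [indicator_far_smul_signed hn hφ hp, integral_const_mul]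

end Exchange

/-! ### Large Gaussian increments -/

section SmallBall

variable {ι : Type*} [Fintype ι]

/-- A lower bound on the tail moment when the small ball has probability less than `1/2`. -/
lemma le_tailCube_of_small_ball {ν : Measure (ι → ℝ)} [IsProbabilityMeasure ν] (hν : MemLp id 3 ν)
    {β : ℝ} (hβ : 0 < β) (h : ν.real {v | β * ‖v‖ ≤ 1 / 4} < 1 / 2) :
    1 / (128 * β ^ 3) ≤ tailCube β ν := by
  have hfar := measurableSet_far (ι := ι) β
  have hc : {v : ι → ℝ | β * ‖v‖ ≤ 1 / 4} = {v : ι → ℝ | 1 / 4 < β * ‖v‖}ᶜ := by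
    ext v; simp
  rw [hc, probReal_compl_eq_one_sub hfar] at h
  have h1 : ∫ v, {v : ι → ℝ | 1 / 4 < β * ‖v‖}.indicator (fun _ => (1 / (4 * β)) ^ 3) v ∂ν ≤
      tailCube β ν := by
    refine integral_mono ((integrable_const _).indicator hfar)
      ((integrable_norm_cube hν).indicator hfar) fun v => ?_
    by_cases hv : v ∈ {v : ι → ℝ | 1 / 4 < β * ‖v‖}
    · rw [Set.indicator_of_mem hv, Set.indicator_of_mem hv]
      have hv' : 1 / 4 < β * ‖v‖ := hv
      refine pow_le_pow_left₀ (by positivity) ?_ 3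
      rw [div_le_iff₀ (by positivity)]
      linarith
    · rw [Set.indicator_of_notMem hv, Set.indicator_of_notMem hv]
  rw [integral_indicator_const _ hfar, smul_eq_mul] at h1
  refine le_trans ?_ h1
  have e : 1 / (128 * β ^ 3) = 1 / 2 * (1 / (4 * β)) ^ 3 := by field_simp; norm_num
  rw [e]
  gcongr
  linarith

end SmallBall

/-! ### From orthants to boxes with infinite endpoints -/

section Hyperrectangle

variable {p : ℕ}

lemma preimage_signed_orthant (a b : Fin p → ℝ) :
    signed p ⁻¹' orthant (fun k => if k.2 then b k.1 else -a k.1) = Set.Icc a b := by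
  ext w
  simp only [orthant, Set.mem_preimage, Set.mem_ofPred_eq, signed_apply, Set.mem_Icc, Pi.le_def]
  constructor
  · intro h
    refine ⟨fun j => ?_, fun j => ?_⟩
    · have := h (j, false)
      simp [boolSign] at this
      exact this
    · have := h (j, true)
      simpa [boolSign] using this
  · rintro ⟨h1, h2⟩ ⟨j, s⟩
    cases s
    · simpa [boolSign] using h1 j
    · simpa [boolSign] using h2 j

lemma abs_real_sub_le_of_mem_hyperrectangles {μ ν : Measure (Fin p → ℝ)} [IsFiniteMeasure μ]
    [IsFiniteMeasure ν] {B : ℝ} (hB : ∀ a b : Fin p → ℝ, |μ.real (Set.Icc a b) -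
      ν.real (Set.Icc a b)| ≤ B) {A : Set (Fin p → ℝ)} (hA : A ∈ hyperrectangles p) :
    |μ.real A - ν.real A| ≤ B := by
  obtain ⟨a, b, -, rfl⟩ := hA
  set A : Set (Fin p → ℝ) := {w | ∀ j, a j ≤ (w j : EReal) ∧ (w j : EReal) ≤ b j} with hA
  rcases A.eq_empty_or_nonempty with h | ⟨w₀, hw₀⟩
  · rw [h]
    simpa using (abs_nonneg _).trans (hB 0 0)
  -- A point of `A` excludes `a j = ⊤` and `b j = ⊥`, so truncating the endpoints at `±m` gives real
  -- numbers; the resulting compact boxes increase to `A`.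
  have ha : ∀ j, a j ≠ ⊤ := fun j hj => by
    have := (hw₀ j).1; rw [hj] at this; exact absurd this (by simp)
  have hb : ∀ j, b j ≠ ⊥ := fun j hj => by
    have := (hw₀ j).2; rw [hj] at this; exact absurd this (by simp)
  set a' : ℕ → Fin p → ℝ := fun m j => (max (a j) ((-(m : ℝ) : ℝ) : EReal)).toReal with ha'
  set b' : ℕ → Fin p → ℝ := fun m j => (min (b j) ((m : ℝ) : EReal)).toReal with hb'
  have hca : ∀ m j, (a' m j : EReal) = max (a j) ((-(m : ℝ) : ℝ) : EReal) := fun m j =>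
    EReal.coe_toReal (max_lt (lt_top_iff_ne_top.2 (ha j)) (EReal.coe_lt_top _)).ne
      ((EReal.bot_lt_coe _).trans_le (le_max_right _ _)).ne'
  have hcb : ∀ m j, (b' m j : EReal) = min (b j) ((m : ℝ) : EReal) := fun m j =>
    EReal.coe_toReal ((min_le_right _ _).trans_lt (EReal.coe_lt_top _)).ne
      (lt_min (bot_lt_iff_ne_bot.2 (hb j)) (EReal.bot_lt_coe _)).ne'
  have hmem : ∀ m (w : Fin p → ℝ), w ∈ Set.Icc (a' m) (b' m) ↔
      w ∈ A ∧ ∀ j, -(m : ℝ) ≤ w j ∧ w j ≤ m := by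
    intro m w
    simp only [Set.mem_Icc, Pi.le_def, hA, Set.mem_ofPred_eq]
    have h1 : ∀ j, a' m j ≤ w j ↔ a j ≤ (w j : EReal) ∧ -(m : ℝ) ≤ w j := fun j => by
      rw [← EReal.coe_le_coe_iff, hca, max_le_iff, EReal.coe_le_coe_iff]
    have h2 : ∀ j, w j ≤ b' m j ↔ (w j : EReal) ≤ b j ∧ w j ≤ m := fun j => by
      rw [← EReal.coe_le_coe_iff, hcb, le_min_iff, EReal.coe_le_coe_iff]
    simp only [h1, h2]
    grind
  have hmono : Monotone fun m => Set.Icc (a' m) (b' m) := by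
    intro m m' hmm w hw
    rw [hmem] at hw ⊢
    have : (m : ℝ) ≤ m' := by exact_mod_cast hmm
    exact ⟨hw.1, fun j => ⟨by linarith [(hw.2 j).1], by linarith [(hw.2 j).2]⟩⟩
  have hunion : ⋃ m, Set.Icc (a' m) (b' m) = A := by
    ext w
    simp only [Set.mem_iUnion, hmem]
    refine ⟨fun ⟨m, h⟩ => h.1, fun h => ?_⟩
    obtain ⟨m, hm⟩ := exists_nat_ge ‖w‖
    exact ⟨m, h, fun j => abs_le.1 ((norm_le_pi_norm w j).trans hm)⟩
  have hlim : ∀ ξ : Measure (Fin p → ℝ), IsFiniteMeasure ξ →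
      Filter.Tendsto (fun m => ξ.real (Set.Icc (a' m) (b' m))) Filter.atTop
        (nhds (ξ.real A)) := by
    intro ξ _
    rw [← hunion]
    exact (ENNReal.tendsto_toReal (measure_ne_top _ _)).comp
      (tendsto_measure_iUnion_atTop hmono)
  exact le_of_tendsto ((hlim μ inferInstance).sub (hlim ν inferInstance)).abs
    (Filter.Eventually.of_forall fun m => hB _ _)

lemma supDist_le_add {𝒜 : Set (Set (Fin p → ℝ))} {μ ν ξ : Measure (Fin p → ℝ)}
    [IsProbabilityMeasure ν] [IsProbabilityMeasure ξ] {B : ℝ} (hB0 : 0 ≤ B)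
    (hB : ∀ A ∈ 𝒜, |μ.real A - ν.real A| ≤ B) : supDist 𝒜 μ ξ ≤ supDist 𝒜 ν ξ + B := by
  have hbdd : BddAbove (Set.range fun A : 𝒜 => |ν.real (A : Set (Fin p → ℝ)) - ξ.real A|) := by
    refine ⟨1, ?_⟩
    rintro _ ⟨A, rfl⟩
    exact abs_sub_le_of_nonneg_of_le measureReal_nonneg measureReal_le_one measureReal_nonneg
      measureReal_le_one
  refine Real.iSup_le (fun A => ?_)
    (add_nonneg (Real.iSup_nonneg fun A => abs_nonneg _) hB0)
  have h1 := abs_sub_le (μ.real (A : Set (Fin p → ℝ))) (ν.real A) (ξ.real A)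
  have h2 := hB A A.2
  have h3 : |ν.real (A : Set (Fin p → ℝ)) - ξ.real A| ≤ supDist 𝒜 ν ξ := le_ciSup hbdd A
  linarith

end Hyperrectangle

/-! ### Exponents produced by the choice of `φ` -/

section Rates

variable {K L ℓ φ n : ℝ}

lemma phi_cube_eq (hL : 0 < L) (hℓ : 0 < ℓ) (hn : 0 < n)
    (hφ : φ = K * (L ^ 2 * ℓ ^ 4 / n) ^ (-(1 / 6) : ℝ)) :
    φ ^ 3 * ℓ ^ 2 * (√n)⁻¹ = K ^ 3 / L := by
  have ha : 0 ≤ L ^ 2 * ℓ ^ 4 / n := by positivity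
  have hn' : 0 < √n := Real.sqrt_pos.2 hn
  have h1 : ((L ^ 2 * ℓ ^ 4 / n) ^ (-(1 / 6) : ℝ)) ^ 3 = (√(L ^ 2 * ℓ ^ 4 / n))⁻¹ := by
    rw [← Real.rpow_natCast, ← Real.rpow_mul ha, Real.sqrt_eq_rpow, ← Real.rpow_neg ha]
    norm_num
  have h2 : √(L ^ 2 * ℓ ^ 4 / n) = L * ℓ ^ 2 / √n := by
    rw [Real.sqrt_div' _ hn.le]
    congr 1
    rw [show L ^ 2 * ℓ ^ 4 = (L * ℓ ^ 2) ^ 2 by ring, Real.sqrt_sq (by positivity)]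
  rw [hφ, mul_pow, h1, h2]
  field_simp

lemma sqrt_div_phi_eq (hK : 0 < K) (hL : 0 < L) (hℓ : 0 < ℓ) (hn : 0 < n)
    (hφ : φ = K * (L ^ 2 * ℓ ^ 4 / n) ^ (-(1 / 6) : ℝ)) :
    √ℓ / φ = K⁻¹ * (L ^ 2 * ℓ ^ 7 / n) ^ (1 / 6 : ℝ) := by
  have ha : 0 < L ^ 2 * ℓ ^ 4 / n := by positivity
  have h1 : √ℓ = (ℓ ^ 3) ^ (1 / 6 : ℝ) := by
    rw [Real.sqrt_eq_rpow, ← Real.rpow_natCast, ← Real.rpow_mul hℓ.le]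
    norm_num
  have h2 : L ^ 2 * ℓ ^ 7 / n = ℓ ^ 3 * (L ^ 2 * ℓ ^ 4 / n) := by ring
  rw [hφ, h2, Real.mul_rpow (by positivity) ha.le, ← h1, Real.rpow_neg ha.le]
  field_simp

end Rates

/-! ### Gaussian approximation of the empirical bootstrap for fixed data -/

section FixedData

/-- The comparison of the two bootstrap laws for fixed data. -/
theorem exists_abs_real_ebLaw_sub_mbLaw_le (b : ℝ) (hb : 0 < b) :
    ∃ K₁ : ℝ, 0 < K₁ ∧ ∃ K₂ : ℝ, 0 < K₂ ∧ ∀ (n p : ℕ), 0 < n → 3 ≤ p →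
      ∀ (x : Fin n → Fin p → ℝ) (Lbar Mbar φ : ℝ), 0 < Lbar →
        φ = K₂ * (Lbar ^ 2 * Real.log p ^ 4 / n) ^ (-(1 / 6) : ℝ) →
        (∀ j, b ≤ empVar x j) → LHat x ≤ Lbar →
        MHatX φ x + ∫ s, truncCube n φ s ∂(mbLaw x) ≤ Mbar →
        ∀ A ∈ hyperrectangles p, |(ebLaw x).real A - (mbLaw x).real A| ≤
          K₁ * ((Lbar ^ 2 * Real.log p ^ 7 / n) ^ ((1 / 6) : ℝ) + Mbar / Lbar) := by
  obtain ⟨g, g₁, g₂, g₃, C, hC, hg⟩ := exists_isCutoff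
  set G := max 1 gaussianAbsCube with hG
  have hG1 : 1 ≤ G := le_max_left _ _
  -- Here `608 = 16 · 38`: after the choice of `φ`, the contraction condition reads `38 C G K₂³ ≤
  -- 1/16`.
  set K₂ : ℝ := 1 / (608 * C * G + 1) with hK₂
  have hCG : 0 < 608 * C * G := by positivity
  have hK₂0 : 0 < K₂ := by positivity
  have hK₂1 : K₂ ≤ 1 := by rw [hK₂, div_le_one (by positivity)]; linarith
  have hK₂3 : K₂ ^ 3 ≤ K₂ := by
    have := pow_le_pow_of_le_one hK₂0.le hK₂1 (show 1 ≤ 3 by norm_num)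
    simpa using this
  have hK₂C : 608 * C * G * K₂ ≤ 1 := by
    rw [hK₂, mul_one_div, div_le_one (by positivity)]; linarith
  set s := √b with hs
  have hs0 : 0 < s := Real.sqrt_pos.2 hb
  -- The first two terms come from the exchange argument, the last two from the case where the
  -- small-ball condition fails.
  refine ⟨330 / s * K₂⁻¹ + 76 * C * K₂ ^ 3 + 128 + s⁻¹, by positivity, K₂, hK₂0, ?_⟩
  intro n p hn hp x L M φ hL hφ hvar hLx hMx A hA
  have hn' : (0 : ℝ) < n := by exact_mod_cast hn
  have hsn : (0 : ℝ) < √n := Real.sqrt_pos.2 hn'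
  have hp' : (3 : ℝ) ≤ p := by exact_mod_cast hp
  have hne : Nonempty (Fin p) := ⟨⟨0, by omega⟩⟩
  set ℓ := Real.log p with hℓ
  have hℓ1 : 1 ≤ ℓ := by
    rw [hℓ, Real.le_log_iff_exp_le (by linarith)]
    linarith [Real.exp_one_lt_d9]
  have hℓ0 : 0 < ℓ := by linarith
  have hφ0 : 0 < φ := by rw [hφ]; positivity
  have hcube := phi_cube_eq hL hℓ0 hn' hφ
  have hrate := sqrt_div_phi_eq hK₂0 hL hℓ0 hn' hφ
  set R := (L ^ 2 * ℓ ^ 7 / n) ^ ((1 / 6) : ℝ) with hR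
  have hR0 : 0 ≤ R := by positivity
  have hMX0 : 0 ≤ MHatX φ x := avg_nonneg fun i => by
    rw [truncCube, maxAbs_eq_norm]; split_ifs <;> positivity
  have hMY0 : 0 ≤ ∫ s, truncCube n φ s ∂(mbLaw x) := integral_nonneg fun s => by
    simp only [Pi.zero_apply, truncCube, maxAbs_eq_norm]; split_ifs <;> positivity
  have hM0 : 0 ≤ M := by linarith
  have hML : 0 ≤ M / L := by positivity
  have hsL : s ^ 3 ≤ L := by
    obtain ⟨j⟩ := hne
    calc s ^ 3 ≤ √(empVar x j) ^ 3 := by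
          have := Real.sqrt_le_sqrt (hvar j)
          gcongr
      _ ≤ L := (sqrt_empVar_pow_le hn x j).trans hLx
  have hempP := isProbabilityMeasure_empiricalMeasure hn x
  have hdraw := isProbabilityMeasure_drawLaw hn x
  have hmS : Measurable (signed p) := (signed p).continuous.measurable
  have hebP : IsProbabilityMeasure (ebLaw x) := by
    refine Measure.isProbabilityMeasure_map (Measurable.aemeasurable ?_)
    unfold empiricalSum normalizedSum; fun_prop
  have hn3 : (n : ℝ) * (√n)⁻¹ ^ 3 = (√n)⁻¹ := by
    calc (n : ℝ) * (√n)⁻¹ ^ 3 = √n * √n * (√n)⁻¹ ^ 3 := by rw [Real.mul_self_sqrt hn'.le]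
      _ = (√n)⁻¹ := by field_simp
  refine abs_real_sub_le_of_mem_hyperrectangles (fun u w => ?_) hA
  rw [← preimage_signed_orthant u w, ← map_measureReal_apply hmS (measurableSet_orthant _),
    ← map_measureReal_apply hmS (measurableSet_orthant _), map_signed_ebLaw hn, ← gaussLaw]
  set y : Fin p × Bool → ℝ := fun k => if k.2 then w k.1 else -u k.1
  by_cases hsmall :
      1 / 2 ≤ (sqrtScale (gaussLaw x) (1 / n)).real {v | φ * ℓ * ‖v‖ ≤ 1 / 4}
  -- The doubled dimension satisfies `2p ≤ p²`.
  · have hcard : (Fintype.card (Fin p × Bool) : ℝ) ≤ Real.exp (2 * ℓ) := by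
      rw [two_mul, Real.exp_add, hℓ, Real.exp_log (by linarith)]
      simp only [Fintype.card_prod, Fintype.card_fin, Fintype.card_bool]
      push_cast
      nlinarith
    have hTle : ∀ c, c ≤ L * G → (√n)⁻¹ ^ 3 * c ≤ (√n)⁻¹ ^ 3 * (L * G) := fun c hc => by gcongr
    have key := abs_real_orthant_convPow_sub_le hg hC hφ0 hℓ1 hcard hn
      (integral_eval_gaussLaw x) hs0 (fun k => Real.sqrt_le_sqrt (hvar k.1)) (map_eval_gaussLaw x)
      (momentsMatch_drawLaw hn x) (T := (√n)⁻¹ ^ 3 * (L * G)) (D := (√n)⁻¹ ^ 3 * M)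
      (fun k => (integral_abs_cube_drawLaw_le x k).trans (hTle _ (by nlinarith)))
      (fun k => (integral_abs_cube_sqrtScale_le hn x k).trans (hTle _ (by
        have h1 : gaussianAbsCube ≤ G := le_max_right _ _
        have := gaussianAbsCube_nonneg
        gcongr)))
      (by
        rw [tailCube_drawLaw hn x hφ0 hℓ0, tailCube_sqrtScale hn x hφ0 hℓ0, ← mul_add]
        gcongr)
      hsmall
      (by
        have h1 : n * (38 * C * (φ * (φ * ℓ) ^ 2)) * ((√n)⁻¹ ^ 3 * (L * G)) =
            38 * C * G * L * (φ ^ 3 * ℓ ^ 2 * (n * (√n)⁻¹ ^ 3)) := by ring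
        rw [h1, hn3, hcube]
        have h2 : 38 * C * G * L * (K₂ ^ 3 / L) = 608 * C * G * K₂ ^ 3 / 16 := by
          field_simp; ring
        rw [h2]
        have := mul_le_mul_of_nonneg_left hK₂3 hCG.le
        linarith) y
    refine key.trans ?_
    have h1 : 2 * (n * (38 * C * (φ * (φ * ℓ) ^ 2)) * ((√n)⁻¹ ^ 3 * M)) =
        76 * C * M * (φ ^ 3 * ℓ ^ 2 * (n * (√n)⁻¹ ^ 3)) := by ring
    rw [h1, hn3, hcube, hrate]
    have h2 : 330 / s * (K₂⁻¹ * R) + 76 * C * M * (K₂ ^ 3 / L) =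
        330 / s * K₂⁻¹ * R + 76 * C * K₂ ^ 3 * (M / L) := by ring
    rw [h2]
    have a1 : 0 ≤ 330 / s * K₂⁻¹ := by positivity
    have a2 : 0 ≤ 76 * C * K₂ ^ 3 := by positivity
    have a3 : 0 ≤ s⁻¹ := by positivity
    have b1 := mul_nonneg a1 hML
    have b2 := mul_nonneg a2 hR0
    have b3 := mul_nonneg a3 (add_nonneg hR0 hML)
    linarith
  · have htail := le_tailCube_of_small_ball (momentsMatch_drawLaw hn x).memLp_right
      (mul_pos hφ0 hℓ0) (not_le.1 hsmall)
    rw [tailCube_sqrtScale hn x hφ0 hℓ0] at htail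
    have hone : |(convPow (drawLaw x) n).real (orthant y) - (gaussLaw x).real (orthant y)| ≤ 1 :=
      abs_sub_le_of_nonneg_of_le measureReal_nonneg measureReal_le_one measureReal_nonneg
        measureReal_le_one
    refine hone.trans ?_
    -- The failure of the small ball forces `1 ≤ 128 (M/L) K₂³ ℓ/n`, which suffices when `ℓ ≤ n`.
    -- When `n ≤ ℓ`, the bounds `L ≥ s³` and `ℓ⁷ ≥ n` give `R ≥ s`.
    have hK1 : 1 ≤ 128 * (M / L) + s⁻¹ * R := by
      rcases le_total ℓ n with h | h
      · have h1 : 1 / (128 * (φ * ℓ) ^ 3) ≤ (√n)⁻¹ ^ 3 * M :=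
          htail.trans (by gcongr; linarith)
        have hφ3 : φ ^ 3 = K₂ ^ 3 / L * √n / ℓ ^ 2 := by
          rw [← hcube]; field_simp
        have hK3 : K₂ ^ 3 ≤ 1 := hK₂3.trans hK₂1
        have h2 : 1 ≤ 128 * (M / L) := by
          rw [div_le_iff₀ (by positivity)] at h1
          have h3 : (√n)⁻¹ ^ 3 * M * (128 * (φ * ℓ) ^ 3) =
              128 * (M / L) * (K₂ ^ 3 * (ℓ * ((√n)⁻¹ * (√n)⁻¹))) := by
            rw [mul_pow, hφ3]; field_simp
          have h4 : (√n)⁻¹ * (√n)⁻¹ = (n : ℝ)⁻¹ := by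
            rw [← mul_inv, Real.mul_self_sqrt hn'.le]
          have h5 : ℓ * (n : ℝ)⁻¹ ≤ 1 := by
            rw [← div_eq_mul_inv, div_le_one hn']; exact h
          rw [h3, h4] at h1
          refine h1.trans (mul_le_of_le_one_right (by positivity) ?_)
          exact mul_le_one₀ hK3 (by positivity) h5
        have : 0 ≤ s⁻¹ * R := by positivity
        linarith
      · have h1 : s ≤ R := by
          have h2 : s = (s ^ 6) ^ (1 / 6 : ℝ) := by
            rw [← Real.rpow_natCast, ← Real.rpow_mul hs0.le]; norm_num
          rw [h2, hR]
          refine Real.rpow_le_rpow (by positivity) ?_ (by norm_num)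
          have h3 : s ^ 6 ≤ L ^ 2 := by
            have := pow_le_pow_left₀ (by positivity) hsL 2
            rwa [← pow_mul] at this
          rw [le_div_iff₀ hn']
          have h4 : (n : ℝ) ≤ ℓ ^ 7 := h.trans (le_self_pow₀ hℓ1 (by norm_num))
          exact mul_le_mul h3 h4 hn'.le (by positivity)
        have h2 : 1 ≤ s⁻¹ * R := by
          rw [inv_mul_eq_div, one_le_div hs0]; exact h1
        linarith
    have a1 : 0 ≤ 330 / s * K₂⁻¹ := by positivity
    have a2 : 0 ≤ 76 * C * K₂ ^ 3 := by positivity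
    have a3 : 0 ≤ s⁻¹ := by positivity
    have b1 := mul_nonneg a1 (add_nonneg hR0 hML)
    have b2 := mul_nonneg a2 (add_nonneg hR0 hML)
    have b3 := mul_nonneg a3 hML
    linarith

end FixedData

/-! ### Identification of the conditional laws -/

section Conditional

/-- The conditional law given `X` of a function of `Z` and `X`. -/
lemma condDistrib_comp_prod {Ω α β γ : Type*} [MeasurableSpace Ω] {P : Measure Ω}
    [IsFiniteMeasure P] [MeasurableSpace α] [StandardBorelSpace α] [Nonempty α]
    [MeasurableSpace β] [MeasurableSpace γ] [StandardBorelSpace γ] [Nonempty γ]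
    {Z : Ω → α} {X : Ω → β} (hZ : Measurable Z) (hX : Measurable X) {f : α → β → γ}
    (hf : Measurable (Function.uncurry f)) :
    ∀ᵐ x ∂(P.map X), condDistrib (fun ω => f (Z ω) (X ω)) X P x =
      (condDistrib Z X P x).map fun z => f z x := by
  have hf' : Measurable fun q : β × α => f q.2 q.1 := hf.comp measurable_swap
  -- This kernel freezes `X = x` and pushes the conditional law of `Z` through `f · x`. It
  -- disintegrates the joint law of `X` and `f Z X`, so essential uniqueness identifies it with the
  -- conditional distribution.
  set κ : Kernel β γ := (Kernel.id ×ₖ condDistrib Z X P).map fun q => f q.2 q.1 with hκ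
  have hκx : ∀ x, κ x = (condDistrib Z X P x).map fun z => f z x := by
    intro x
    rw [hκ, Kernel.map_apply _ hf', Kernel.prod_apply, Kernel.id_apply, Measure.dirac_prod,
      Measure.map_map hf' (by fun_prop)]
    rfl
  have hκP : IsFiniteKernel κ := by
    rw [hκ]; exact Kernel.IsFiniteKernel.map _ _
  have h := condDistrib_ae_eq_of_measure_eq_compProd (μ := P) (Y := fun ω => f (Z ω) (X ω))
    X (hf.comp (hZ.prodMk hX)).aemeasurable (κ := κ) (by
      have hg : Measurable fun q : β × α => (q.1, f q.2 q.1) := measurable_fst.prodMk hf'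
      have h1 : P.map (fun ω => (X ω, f (Z ω) (X ω))) =
          (P.map X ⊗ₘ condDistrib Z X P).map fun q => (q.1, f q.2 q.1) := by
        rw [compProd_map_condDistrib hZ.aemeasurable, Measure.map_map hg (hX.prodMk hZ)]
        rfl
      rw [h1]
      ext t ht
      rw [Measure.map_apply hg ht, Measure.compProd_apply (hg ht), Measure.compProd_apply ht]
      refine lintegral_congr fun x => ?_
      have hfx : Measurable fun z => f z x := hf'.comp measurable_prodMk_left
      rw [hκx, Measure.map_apply hfx (measurable_prodMk_left ht)]
      rfl)
  filter_upwards [h] with x hx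
  rw [hx, hκx]

lemma condDistrib_of_indepFun {Ω α β : Type*} [MeasurableSpace Ω] {P : Measure Ω}
    [IsProbabilityMeasure P] [MeasurableSpace α] [StandardBorelSpace α] [Nonempty α]
    [MeasurableSpace β] {Z : Ω → α} {X : Ω → β} (hZ : Measurable Z) (hX : Measurable X)
    (h : IndepFun Z X P) : ∀ᵐ x ∂(P.map X), condDistrib Z X P x = P.map Z := by
  have := Measure.isProbabilityMeasure_map (μ := P) hZ.aemeasurable
  have h1 := (indepFun_iff_map_prod_eq_prod_map_map hX.aemeasurable hZ.aemeasurable).1 h.symm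
  have h2 := condDistrib_ae_eq_of_measure_eq_compProd (μ := P) X hZ.aemeasurable
    (κ := Kernel.const β (P.map Z)) (by rw [h1, Measure.compProd_const])
  filter_upwards [h2] with x hx
  rw [hx, Kernel.const_apply]

variable {Ω : Type*} [MeasurableSpace Ω] {P : Measure Ω} [IsProbabilityMeasure P] {n p : ℕ}

lemma measurable_data {X : Fin n → Ω → Fin p → ℝ} (hX : ∀ i, Measurable (X i)) :
    Measurable (data X) := measurable_pi_lambda _ hX

lemma ae_condLawMB_eq {X : Fin n → Ω → Fin p → ℝ} {e : Fin n → Ω → ℝ}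
    (hX : ∀ i, Measurable (X i)) (he : IsMultiplier P e X) :
    ∀ᵐ ω ∂P, condLawMB P e X ω = mbLaw (data X ω) := by
  have hem : Measurable fun ω i => e i ω := measurable_pi_lambda _ he.measurable
  have hlaw : P.map (fun ω i => e i ω) = Measure.pi fun _ => gaussianReal 0 1 := by
    rw [(iIndepFun_iff_map_fun_eq_pi_map fun i => (he.measurable i).aemeasurable).1 he.indep]
    simp only [he.law]
  have hf : Measurable (Function.uncurry fun (ε : Fin n → ℝ) (x : Fin n → Fin p → ℝ) =>
      multiplierSum ε x) := by
    unfold Function.uncurry multiplierSum normalizedSum sampleMean avg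
    fun_prop
  have h1 := condDistrib_comp_prod (P := P) hem (measurable_data hX) hf
  have h2 := condDistrib_of_indepFun hem (measurable_data hX) he.indep_data
  filter_upwards [ae_of_ae_map (measurable_data hX).aemeasurable h1,
    ae_of_ae_map (measurable_data hX).aemeasurable h2] with ω hω1 hω2
  rw [condLawMB, hω1, hω2, hlaw, mbLaw]

lemma ae_condLawEB_eq {X Xs : Fin n → Ω → Fin p → ℝ} (hX : ∀ i, Measurable (X i))
    (hXs : IsEmpiricalDraw P Xs X) : ∀ᵐ ω ∂P, condLawEB P Xs X ω = ebLaw (data X ω) := by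
  have hf : Measurable (Function.uncurry fun (xs x : Fin n → Fin p → ℝ) =>
      empiricalSum xs x) := by
    unfold Function.uncurry empiricalSum normalizedSum sampleMean avg
    fun_prop
  have h1 := condDistrib_comp_prod (P := P) (measurable_data hXs.measurable) (measurable_data hX) hf
  filter_upwards [ae_of_ae_map (measurable_data hX).aemeasurable h1,
    ae_of_ae_map (measurable_data hX).aemeasurable hXs.condLaw] with ω hω1 hω2
  rw [condLawEB, hω1, hω2, ebLaw]

end Conditional

end HDBootstrap

end

/-! ### The bootstrap comparison -/

theorem mainTheorem10 (b : ℝ) (hb : 0 < b) :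
    ∃ K₁ : ℝ, 0 < K₁ ∧ ∃ K₂ : ℝ, 0 < K₂ ∧
      ∀ (n p : ℕ), 4 ≤ n → 3 ≤ p →
      ∀ (Ω : Type*) [MeasurableSpace Ω] (P : Measure Ω) [IsProbabilityMeasure P]
        (X Y Xs : Fin n → Ω → Fin p → ℝ) (e : Fin n → Ω → ℝ),
        HDBootstrap.IsSample P X Y →
        HDBootstrap.IsMultiplier P e X →
        HDBootstrap.IsEmpiricalDraw P Xs X →
      ∀ᵐ ω ∂P, ∀ (Lbar Mbar φ : ℝ), 0 < Lbar → 0 < Mbar →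
        φ = K₂ * (Lbar ^ 2 * Real.log p ^ 4 / n) ^ (-(1 / 6) : ℝ) →
        (∀ j, b ≤ HDBootstrap.empVar (HDBootstrap.data X ω) j) →
        HDBootstrap.LHat (HDBootstrap.data X ω) ≤ Lbar →
        HDBootstrap.MHat P φ e X ω ≤ Mbar →
        HDBootstrap.rhoEB P (HDBootstrap.hyperrectangles p) Xs X Y ω ≤
          HDBootstrap.rhoMB P (HDBootstrap.hyperrectangles p) e X Y ω +
            K₁ * ((Lbar ^ 2 * Real.log p ^ 7 / n) ^ ((1 / 6) : ℝ) + Mbar / Lbar) := by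
  obtain ⟨K₁, hK₁, K₂, hK₂, key⟩ := HDBootstrap.exists_abs_real_ebLaw_sub_mbLaw_le b hb
  refine ⟨K₁, hK₁, K₂, hK₂, fun n p hn hp Ω _ P _ X Y Xs e hXY he hXs => ?_⟩
  -- These two identifications are the only exceptional sets; they are fixed before the constants
  -- `Lbar` and `Mbar` are chosen.
  filter_upwards [HDBootstrap.ae_condLawMB_eq hXY.measurable_X he,
    HDBootstrap.ae_condLawEB_eq hXY.measurable_X hXs] with ω hMB hEB
  intro Lbar Mbar φ hL hM hφ hvar hLhat hMhat
  rw [HDBootstrap.MHat, HDBootstrap.MHatY, hMB] at hMhat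
  have h := key n p (by omega) hp (HDBootstrap.data X ω) Lbar Mbar φ hL hφ hvar hLhat hMhat
  have hY : IsProbabilityMeasure (HDBootstrap.lawSum P Y) := by
    refine Measure.isProbabilityMeasure_map (Measurable.aemeasurable ?_)
    have := HDBootstrap.measurable_data hXY.measurable_Y
    unfold HDBootstrap.normalizedSum
    fun_prop
  rw [HDBootstrap.rhoEB, HDBootstrap.rhoMB, hMB, hEB]
  exact HDBootstrap.supDist_le_add (by positivity) h
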